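/- Let $\mathbb F$ be an algebraically closed field and let $q\in\mathbb F^\times$ be a root of unity with $q^4\neq 1$. Let $d$ be the order of $q$, and put $\bar d=d$ if $d$ is odd and $\bar d=d/2$ if $d$ is even. The universal Askey--Wilson algebra $\triangle_q$ is the unital associative $\mathbb F$-algebra generated by $A,B,C$ subject to the relations that each of $$A+\frac{qBC-q^{-1}CB}{q^2-q^{-2}},\qquad B+\frac{qCA-q^{-1}AC}{q^2-q^{-2}},\qquad C+\frac{qAB-q^{-1}BA}{q^2-q^{-2}}$$ is central; let $\alpha,\beta,\gamma$ be $q+q^{-1}$ times these elements. For $(a,b,c,\lambda)\in(\mathbb F^\times)^4$ and $i\in\mathbb N=\{0,1,2,\dots\}$ put $\theta_i=a\lambda^{-1}q^{2i}+a^{-1}\lambda q^{-2i}$, $\theta_i^*=b\lambda^{-1}q^{2i}+b^{-1}\lambda q^{-2i}$ and $$\varphi_i=a^{-1}b^{-1}\lambda q(q^i-q^{-i})(\lambda^{-1}q^{i-1}-\lambda q^{1-i})(q^{-i}-abc\lambda^{-1}q^{i-1})(q^{-i}-abc^{-1}\lambda^{-1}q^{i-1}).$$ The Verma module $M_\lambda(a,b,c)$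 is the $\triangle_q$-module with $\mathbb F$-basis $\{m_i\}_{i\in\mathbb N}$ such that $(A-\theta_i)m_i=m_{i+1}$ for $i\ge 0$, $(B-\theta_i^*)m_i=\varphi_i m_{i-1}$ for $i\ge 1$, $(B-\theta_0^*)m_0=0$, and $\alpha,\beta,\gamma$ act as multiplication by the scalars $$(b+b^{-1})(c+c^{-1})+(a+a^{-1})(\lambda q+\lambda^{-1}q^{-1}),$$ $$(c+c^{-1})(a+a^{-1})+(b+b^{-1})(\lambda q+\lambda^{-1}q^{-1}),$$ $$(a+a^{-1})(b+b^{-1})+(c+c^{-1})(\lambda q+\lambda^{-1}q^{-1})$$ respectively. For $\delta\in\mathbb F$ the subspace $O_\lambda^\delta(a,b,c)$ of $M_\lambda(a,b,c)$ spanned by $\{\delta m_i-m_{\bar d+i}\}_{i\in\mathbb N}$ is a submodule. Put $W_\lambda^\delta(a,b,c)=M_\lambda(a,b,c)/O_\lambda^\delta(a,b,c)$ and let $w_0$ be the image of $m_0$ in it. Let $\{\pm1\}$ act on $(\mathbb F^\times)^4$ by $(-1)\cdot(a,b,c,\lambda)=(-a,-b,-c,-\lambda)$. The symmetric group $\mathfrak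 S_4$ acts on the right on the set $\{\pm1\}\backslash(\mathbb F^\times)^4$ of orbits, uniquely, so that $(1\,2)$, $(2\,3)$, $(3\,4)$ send the orbit of $(a,b,c,\lambda)$ to the orbits of $(a,b,c^{-1},\lambda)$, of $(a/s,b/s,c/s,\lambda/s)$ with $s^2=abc\lambda q$, and of $(a^{-1},b,c,\lambda)$, respectively. Write $(a,b,c,\lambda)\approx(\bar a,\bar b,\bar c,\bar\lambda)$ if the $\mathfrak S_4$-orbits of $\{\pm1\}\cdot(a,b,c,\lambda)$ and $\{\pm1\}\cdot(\bar a,\bar b,\bar c,\bar\lambda)$ coincide. Write $(a,b,c,\lambda,\delta)\simeq(\bar a,\bar b,\bar c,\bar\lambda,\bar\delta)$ if $(a,b,c,\lambda)\approx(\bar a,\bar b,\bar c,\bar\lambda)$ and $$\delta+a^{\bar d}\lambda^{-\bar d}+a^{-\bar d}\lambda^{\bar d}=\bar\delta+\bar a^{\bar d}\bar\lambda^{-\bar d}+\bar a^{-\bar d}\bar\lambda^{\bar d}.$$ (1) For all $(a,b,c,\lambda),(\bar a,\bar b,\bar c,\bar\lambda)\in(\mathbb F^\times)^4$, with $m_0,\bar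 m_0$ the first basis vectors of $M_\lambda(a,b,c)$ and $M_{\bar\lambda}(\bar a,\bar b,\bar c)$, the following are equivalent: (i) $(a,b,c,\lambda)\approx(\bar a,\bar b,\bar c,\bar\lambda)$; (ii) there is a $\triangle_q$-module homomorphism $M_\lambda(a,b,c)\to M_{\bar\lambda}(\bar a,\bar b,\bar c)$ with $m_0\mapsto\bar m_0$; (iii) there is a $\triangle_q$-module homomorphism $M_{\bar\lambda}(\bar a,\bar b,\bar c)\to M_\lambda(a,b,c)$ with $\bar m_0\mapsto m_0$; (iv) there is a $\triangle_q$-module isomorphism $M_\lambda(a,b,c)\to M_{\bar\lambda}(\bar a,\bar b,\bar c)$ with $m_0\mapsto\bar m_0$; (v) there is a $\triangle_q$-module isomorphism $M_{\bar\lambda}(\bar a,\bar b,\bar c)\to M_\lambda(a,b,c)$ with $\bar m_0\mapsto m_0$. (2) For all $(a,b,c,\lambda,\delta),(\bar a,\bar b,\bar c,\bar\lambda,\bar\delta)\in(\mathbb F^\times)^4\times\mathbb F$, with $w_0,\bar w_0$ the images of $m_0,\bar m_0$ in $W_\lambda^\delta(a,b,c)$ and $W_{\bar\lambda}^{\bar\delta}(\bar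 a,\bar b,\bar c)$, the following are equivalent: (i) $(a,b,c,\lambda,\delta)\simeq(\bar a,\bar b,\bar c,\bar\lambda,\bar\delta)$; (ii) there is a $\triangle_q$-module homomorphism $W_\lambda^\delta(a,b,c)\to W_{\bar\lambda}^{\bar\delta}(\bar a,\bar b,\bar c)$ with $w_0\mapsto\bar w_0$; (iii) there is a $\triangle_q$-module homomorphism $W_{\bar\lambda}^{\bar\delta}(\bar a,\bar b,\bar c)\to W_\lambda^\delta(a,b,c)$ with $\bar w_0\mapsto w_0$; (iv) there is a $\triangle_q$-module isomorphism $W_\lambda^\delta(a,b,c)\to W_{\bar\lambda}^{\bar\delta}(\bar a,\bar b,\bar c)$ with $w_0\mapsto\bar w_0$; (v) there is a $\triangle_q$-module isomorphism $W_{\bar\lambda}^{\bar\delta}(\bar a,\bar b,\bar c)\to W_\lambda^\delta(a,b,c)$ with $\bar w_0\mapsto w_0$. -/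

import Mathlib

noncomputable section

namespace AskeyWilson

/-! ## The universal Askey-Wilson algebra -/

section Algebra

variable {F : Type*} [Field F]

/-- The names of the three generators. -/
inductive Gen : Type
  | A
  | B
  | C

/-- For elements `X, Y, Z` of an `F`-algebra, the element
`X + (q Y Z - q⁻¹ Z Y) / (q² - q⁻²)`. -/
def cas (q : Fˣ) {R : Type*} [Ring R] [Algebra F R] (X Y Z : R) : R :=
  X + ((q : F) ^ 2 - ((q : F)⁻¹) ^ 2)⁻¹ • ((q : F) • (Y * Z) - (q : F)⁻¹ • (Z * Y))

open FreeAlgebra in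
/-- The defining relations: each of `A + (qBC - q⁻¹CB)/(q² - q⁻²)`,
`B + (qCA - q⁻¹AC)/(q² - q⁻²)`, `C + (qAB - q⁻¹BA)/(q² - q⁻²)` commutes with each generator. -/
inductive Rel (q : Fˣ) : FreeAlgebra F Gen → FreeAlgebra F Gen → Prop
  | alpha (g : Gen) :
      Rel q (cas q (ι F Gen.A) (ι F Gen.B) (ι F Gen.C) * ι F g)
        (ι F g * cas q (ι F Gen.A) (ι F Gen.B) (ι F Gen.C))
  | beta (g : Gen) :
      Rel q (cas q (ι F Gen.B) (ι F Gen.C) (ι F Gen.A) * ι F g)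
        (ι F g * cas q (ι F Gen.B) (ι F Gen.C) (ι F Gen.A))
  | gamma (g : Gen) :
      Rel q (cas q (ι F Gen.C) (ι F Gen.A) (ι F Gen.B) * ι F g)
        (ι F g * cas q (ι F Gen.C) (ι F Gen.A) (ι F Gen.B))

/-- The universal Askey-Wilson algebra. -/
abbrev UAW (q : Fˣ) : Type _ := RingQuot (Rel q)

/-- The generators of the universal Askey-Wilson algebra. -/
def gen (q : Fˣ) (g : Gen) : UAW q := RingQuot.mkAlgHom F (Rel q) (FreeAlgebra.ι F g)

/-- The central element `α`, normalised by
`α / (q + q⁻¹) = A + (q B C - q⁻¹ C B) / (q² - q⁻²)`. -/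
def alpha (q : Fˣ) : UAW q :=
  ((q : F) + (q : F)⁻¹) • cas q (gen q Gen.A) (gen q Gen.B) (gen q Gen.C)

/-- The central element `β`. -/
def beta (q : Fˣ) : UAW q :=
  ((q : F) + (q : F)⁻¹) • cas q (gen q Gen.B) (gen q Gen.C) (gen q Gen.A)

/-- The central element `γ`. -/
def gamma (q : Fˣ) : UAW q :=
  ((q : F) + (q : F)⁻¹) • cas q (gen q Gen.C) (gen q Gen.A) (gen q Gen.B)

/-- A set of elements closed under the algebra operations and containing the generators is
everything. -/
theorem UAW.induction (q : Fˣ) (P : UAW q → Prop)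
    (hs : ∀ r : F, P (algebraMap F (UAW q) r)) (hg : ∀ g, P (gen q g))
    (hm : ∀ x y, P x → P y → P (x * y)) (ha : ∀ x y, P x → P y → P (x + y)) (x : UAW q) :
    P x := by
  obtain ⟨z, rfl⟩ := RingQuot.mkAlgHom_surjective F (Rel q) x
  induction z using FreeAlgebra.induction with
  | grade0 r => simpa using hs r
  | grade1 g => exact hg g
  | mul x y hx hy => rw [map_mul]; exact hm _ _ hx hy
  | add x y hx hy => rw [map_add]; exact ha _ _ hx hy

end Algebra

/-! ## Quadruples of nonzero scalars -/

/-- A quadruple `(a, b, c, λ)` of nonzero scalars (`l` stands for `λ`). -/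
@[ext] structure Quad (F : Type*) [Field F] where
  a : Fˣ
  b : Fˣ
  c : Fˣ
  l : Fˣ

section Quad

variable {F : Type*} [Field F]

/-- The action of `{±1}` on quadruples: `-1` sends `(a, b, c, λ)` to `(-a, -b, -c, -λ)`. -/
instance : MulAction ℤˣ (Quad F) where
  smul e p :=
    { a := Units.map (Int.castRingHom F : ℤ →* F) e * p.a
      b := Units.map (Int.castRingHom F : ℤ →* F) e * p.b
      c := Units.map (Int.castRingHom F : ℤ →* F) e * p.c
      l := Units.map (Int.castRingHom F : ℤ →* F) e * p.l }
  one_smul p := by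
    change Quad.mk _ _ _ _ = p
    simp
  mul_smul e f p := by
    change Quad.mk _ _ _ _ = Quad.mk _ _ _ _
    simp only [map_mul, mul_assoc]
    rfl

theorem neg_one_smul_quad (a b c l : Fˣ) :
    (-1 : ℤˣ) • (⟨a, b, c, l⟩ : Quad F) = ⟨-a, -b, -c, -l⟩ := by
  have h : Units.map (Int.castRingHom F : ℤ →* F) (-1) = -1 := by
    ext; simp
  change Quad.mk _ _ _ _ = Quad.mk _ _ _ _
  rw [h]; simp

variable (F) in
/-- The set of `{±1}`-orbits of quadruples. -/
abbrev SignOrbits : Type _ := MulAction.orbitRel.Quotient ℤˣ (Quad F)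

/-- The `{±1}`-orbit of a quadruple. -/
def Quad.orb (p : Quad F) : SignOrbits F := Quotient.mk _ p

/-- Target of the coordinates on `{±1}`-orbits below. -/
def CoordSpace (q : Fˣ) : Type _ :=
  {y : (Fin 4 → Fˣ) × Fˣ // y.1 0 * y.1 1 * y.1 2 * y.1 3 = (y.2 * q) ^ 2}

/-- The sign-invariant quantities `(b c⁻¹ q, b c q, a⁻¹ λ⁻¹, a λ⁻¹)` and `b λ⁻¹`. -/
def coord (q : Fˣ) (p : Quad F) : CoordSpace q :=
  ⟨(![p.b * p.c⁻¹ * q, p.b * p.c * q, p.a⁻¹ * p.l⁻¹, p.a * p.l⁻¹], p.b * p.l⁻¹), by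
    simp only [Matrix.cons_val]
    ext
    push_cast
    field_simp⟩

theorem coord_eq_iff (q : Fˣ) (p r : Quad F) :
    coord q p = coord q r ↔ ∃ e : ℤˣ, e • r = p := by
  constructor
  · intro h
    have h1 := congrArg (fun y : CoordSpace q => y.1.1 1) h
    have h2 := congrArg (fun y : CoordSpace q => y.1.1 2) h
    have h3 := congrArg (fun y : CoordSpace q => y.1.1 3) h
    have h4 := congrArg (fun y : CoordSpace q => y.1.2) h
    simp only [coord, Matrix.cons_val] at h1 h2 h3 h4
    have key : p.l ^ 2 = r.l ^ 2 := by
      have := congrArg₂ (· * ·) h2 h3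
      have e1 : ∀ x y : Fˣ, x⁻¹ * y⁻¹ * (x * y⁻¹) = (y ^ 2)⁻¹ := by
        intro x y; ext; push_cast; field_simp
      simpa only [e1, inv_inj] using this
    have key2 : p.l = r.l ∨ p.l = -r.l := by
      have h5 : (p.l : F) ^ 2 = (r.l : F) ^ 2 := by exact_mod_cast congrArg Units.val key
      rcases sq_eq_sq_iff_eq_or_eq_neg.mp h5 with h6 | h6
      · left; ext; exact h6
      · right; ext; simpa using h6
    have ha : p.a = r.a * r.l⁻¹ * p.l := by rw [← h3]; simp
    have hb : p.b = r.b * r.l⁻¹ * p.l := by rw [← h4]; simp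
    have hc : p.c = p.b⁻¹ * (r.b * r.c) := by
      have h1' := mul_right_cancel h1
      rw [← h1']; simp
    obtain ⟨a, b, c, l⟩ := p
    obtain ⟨a', b', c', l'⟩ := r
    simp only at *
    subst ha hb hc
    rcases key2 with rfl | rfl
    · exact ⟨1, by rw [one_smul]; simp⟩
    · refine ⟨-1, ?_⟩
      rw [neg_one_smul_quad]
      ext <;> push_cast <;> field_simp
  · rintro ⟨e, rfl⟩
    rcases Int.units_eq_one_or e with rfl | rfl
    · rw [one_smul]
    · obtain ⟨a, b, c, l⟩ := r
      rw [neg_one_smul_quad]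
      apply Subtype.ext
      simp [coord]

variable [IsAlgClosed F]

theorem exists_unit_sq (x : Fˣ) : ∃ s : Fˣ, s ^ 2 = x := by
  obtain ⟨z, hz⟩ := IsAlgClosed.exists_pow_nat_eq (x : F) (n := 2) (by norm_num)
  have hz0 : z ≠ 0 := by
    rintro rfl
    exact x.ne_zero (by rw [← hz]; simp)
  exact ⟨Units.mk0 z hz0, by ext; simpa using hz⟩

theorem coord_surjective (q : Fˣ) : Function.Surjective (coord (F := F) q) := by
  rintro ⟨⟨y, m⟩, hy⟩
  simp only at hy
  obtain ⟨l, hl⟩ := exists_unit_sq (y 2 * y 3)⁻¹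
  refine ⟨⟨y 3 * l, m * l, y 1 * (m * l * q)⁻¹, l⟩, ?_⟩
  have h0 : y 0 = (m * q) ^ 2 * l ^ 2 * (y 1)⁻¹ := by
    rw [hl, ← hy]; ext; push_cast; field_simp
  have h2 : y 2 = (y 3)⁻¹ * (l ^ 2)⁻¹ := by
    rw [hl]; ext; push_cast; field_simp
  apply Subtype.ext
  refine Prod.ext ?_ ?_
  · funext i
    fin_cases i
    · change m * l * (y 1 * (m * l * q)⁻¹)⁻¹ * q = y 0
      rw [h0]; ext; push_cast; field_simp
    · change m * l * (y 1 * (m * l * q)⁻¹) * q = y 1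
      ext; push_cast; field_simp
    · change (y 3 * l)⁻¹ * l⁻¹ = y 2
      rw [h2]; ext; push_cast; field_simp
    · change (y 3 * l) * l⁻¹ = y 3
      simp
  · change m * l * l⁻¹ = m
    simp

/-- The coordinates identify the `{±1}`-orbits with `CoordSpace`. -/
def coordEquiv (q : Fˣ) : SignOrbits F ≃ CoordSpace q :=
  Equiv.ofBijective
    (Quotient.lift (coord q) (fun p r h => (coord_eq_iff q p r).mpr h))
    ⟨by
      intro x y
      induction x using Quotient.inductionOn with | _ p
      induction y using Quotient.inductionOn with | _ r
      intro h
      exact Quotient.sound ((coord_eq_iff q p r).mp h),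
     by
      intro y
      obtain ⟨p, hp⟩ := coord_surjective q y
      exact ⟨Quotient.mk _ p, hp⟩⟩

theorem coordEquiv_orb (q : Fˣ) (p : Quad F) : coordEquiv q p.orb = coord q p := rfl

/-- Permuting the four coordinates. -/
def permCoord (q : Fˣ) (y : CoordSpace q) (σ : Equiv.Perm (Fin 4)) : CoordSpace q :=
  ⟨(y.1.1 ∘ σ, y.1.2), by
    have h := Equiv.prod_comp σ y.1.1
    simp only [Fin.prod_univ_four] at h
    simpa only [Function.comp] using h.trans y.2⟩

/-- The right action of the symmetric group `S₄` on `{±1}`-orbits of quadruples. In the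
coordinates above it permutes four entries. It is the unique right action with the values
on the three adjacent transpositions given in `s4Act_12`, `s4Act_23`, `s4Act_34`
(the letters `1, 2, 3, 4` are `0, 1, 2, 3 : Fin 4`). -/
def s4Act (q : Fˣ) (x : SignOrbits F) (σ : Equiv.Perm (Fin 4)) : SignOrbits F :=
  (coordEquiv q).symm (permCoord q (coordEquiv q x) σ)

theorem s4Act_one (q : Fˣ) (x : SignOrbits F) : s4Act q x 1 = x := by
  have : permCoord q (coordEquiv q x) 1 = coordEquiv q x := rfl
  rw [s4Act, this, Equiv.symm_apply_apply]

theorem s4Act_mul (q : Fˣ) (x : SignOrbits F) (σ τ : Equiv.Perm (Fin 4)) :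
    s4Act q x (σ * τ) = s4Act q (s4Act q x σ) τ := by
  simp only [s4Act, Equiv.apply_symm_apply]
  rfl

/-- `({±1}·(a, b, c, λ))·(1 2) = {±1}·(a, b, c⁻¹, λ)`. -/
theorem s4Act_12 (q a b c l : Fˣ) :
    s4Act q (Quad.orb ⟨a, b, c, l⟩) (Equiv.swap 0 1) = Quad.orb ⟨a, b, c⁻¹, l⟩ := by
  rw [s4Act, Equiv.symm_apply_eq, coordEquiv_orb, coordEquiv_orb]
  apply Subtype.ext
  refine Prod.ext (funext fun i => ?_) rfl
  fin_cases i <;> simp [permCoord, coord]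

/-- `({±1}·(a, b, c, λ))·(2 3) = {±1}·(a/s, b/s, c/s, λ/s)`, where `s` is a square root
of `a b c λ q`. -/
theorem s4Act_23 (q a b c l s : Fˣ) (hs : s ^ 2 = a * b * c * l * q) :
    s4Act q (Quad.orb ⟨a, b, c, l⟩) (Equiv.swap 1 2) =
      Quad.orb ⟨a / s, b / s, c / s, l / s⟩ := by
  rw [s4Act, Equiv.symm_apply_eq, coordEquiv_orb, coordEquiv_orb]
  have hq : q = s ^ 2 * (a * b * c * l)⁻¹ := by rw [hs]; ext; push_cast; field_simp
  apply Subtype.ext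
  refine Prod.ext (funext fun i => ?_) ?_
  · fin_cases i
    · change b * c⁻¹ * q = b / s * (c / s)⁻¹ * q
      ext; push_cast; field_simp
    · change a⁻¹ * l⁻¹ = b / s * (c / s) * q
      rw [hq]; ext; push_cast; field_simp
    · change b * c * q = (a / s)⁻¹ * (l / s)⁻¹
      rw [hq]; ext; push_cast; field_simp
    · change a * l⁻¹ = a / s * (l / s)⁻¹
      ext; push_cast; field_simp
  · change b * l⁻¹ = b / s * (l / s)⁻¹
    ext; push_cast; field_simp

/-- `({±1}·(a, b, c, λ))·(3 4) = {±1}·(a⁻¹, b, c, λ)`. -/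
theorem s4Act_34 (q a b c l : Fˣ) :
    s4Act q (Quad.orb ⟨a, b, c, l⟩) (Equiv.swap 2 3) = Quad.orb ⟨a⁻¹, b, c, l⟩ := by
  rw [s4Act, Equiv.symm_apply_eq, coordEquiv_orb, coordEquiv_orb]
  apply Subtype.ext
  refine Prod.ext (funext fun i => ?_) rfl
  fin_cases i <;> simp [permCoord, coord, Equiv.swap_apply_def]

/-- Two quadruples are `{±1} × S₄`-equivalent if the `S₄`-orbits of their `{±1}`-orbits
coincide. -/
def QuadEquiv (q : Fˣ) (p r : Quad F) : Prop :=
  Set.range (s4Act q p.orb) = Set.range (s4Act q r.orb)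

end Quad

/-! ## Verma modules -/

section Verma

variable {F : Type*} [Field F]

/-- `θ_i = a λ⁻¹ q^{2i} + a⁻¹ λ q^{-2i}`. -/
def theta (q : Fˣ) (p : Quad F) (i : ℕ) : F :=
  (p.a : F) * (p.l : F)⁻¹ * (q : F) ^ (2 * (i : ℤ)) +
    (p.a : F)⁻¹ * (p.l : F) * (q : F) ^ (-2 * (i : ℤ))

/-- `θ*_i = b λ⁻¹ q^{2i} + b⁻¹ λ q^{-2i}`. -/
def thetaStar (q : Fˣ) (p : Quad F) (i : ℕ) : F :=
  (p.b : F) * (p.l : F)⁻¹ * (q : F) ^ (2 * (i : ℤ)) +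
    (p.b : F)⁻¹ * (p.l : F) * (q : F) ^ (-2 * (i : ℤ))

/-- The scalars `φ_i`. -/
def phi (q : Fˣ) (p : Quad F) (i : ℕ) : F :=
  (p.a : F)⁻¹ * (p.b : F)⁻¹ * (p.l : F) * (q : F) *
    ((q : F) ^ (i : ℤ) - (q : F) ^ (-(i : ℤ))) *
    ((p.l : F)⁻¹ * (q : F) ^ ((i : ℤ) - 1) - (p.l : F) * (q : F) ^ (1 - (i : ℤ))) *
    ((q : F) ^ (-(i : ℤ)) -
      (p.a : F) * (p.b : F) * (p.c : F) * (p.l : F)⁻¹ * (q : F) ^ ((i : ℤ) - 1)) *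
    ((q : F) ^ (-(i : ℤ)) -
      (p.a : F) * (p.b : F) * (p.c : F)⁻¹ * (p.l : F)⁻¹ * (q : F) ^ ((i : ℤ) - 1))

/-- The scalar by which `α` acts. -/
def omega (q : Fˣ) (p : Quad F) : F :=
  ((p.b : F) + (p.b : F)⁻¹) * ((p.c : F) + (p.c : F)⁻¹) +
    ((p.a : F) + (p.a : F)⁻¹) * ((p.l : F) * (q : F) + (p.l : F)⁻¹ * (q : F)⁻¹)

/-- The scalar by which `β` acts. -/
def omegaStar (q : Fˣ) (p : Quad F) : F :=
  ((p.c : F) + (p.c : F)⁻¹) * ((p.a : F) + (p.a : F)⁻¹) +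
    ((p.b : F) + (p.b : F)⁻¹) * ((p.l : F) * (q : F) + (p.l : F)⁻¹ * (q : F)⁻¹)

/-- The scalar by which `γ` acts. -/
def omegaEps (q : Fˣ) (p : Quad F) : F :=
  ((p.a : F) + (p.a : F)⁻¹) * ((p.b : F) + (p.b : F)⁻¹) +
    ((p.c : F) + (p.c : F)⁻¹) * ((p.l : F) * (q : F) + (p.l : F)⁻¹ * (q : F)⁻¹)

/-- `A m_i = θ_i m_i + m_{i+1}`. -/
def opA (q : Fˣ) (p : Quad F) : Module.End F (ℕ →₀ F) :=
  Finsupp.linearCombination F fun i =>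
    theta q p i • Finsupp.single i (1 : F) + Finsupp.single (i + 1) (1 : F)

/-- `B m_i = θ*_i m_i + φ_i m_{i-1}`; here `φ_0 = 0`. -/
def opB (q : Fˣ) (p : Quad F) : Module.End F (ℕ →₀ F) :=
  Finsupp.linearCombination F fun i =>
    thetaStar q p i • Finsupp.single i (1 : F) + phi q p i • Finsupp.single (i - 1) (1 : F)

/-- `C`, determined by `A`, `B` and the scalar by which `γ` acts. -/
def opC (q : Fˣ) (p : Quad F) : Module.End F (ℕ →₀ F) :=
  (omegaEps q p * ((q : F) + (q : F)⁻¹)⁻¹) • 1 -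
    ((q : F) ^ 2 - ((q : F)⁻¹) ^ 2)⁻¹ •
      ((q : F) • (opA q p * opB q p) - (q : F)⁻¹ • (opB q p * opA q p))

theorem opA_single (q : Fˣ) (p : Quad F) (i : ℕ) :
    opA q p (Finsupp.single i 1) =
      theta q p i • Finsupp.single i (1 : F) + Finsupp.single (i + 1) (1 : F) := by
  simp [opA, Finsupp.linearCombination_single]

theorem opB_single (q : Fˣ) (p : Quad F) (i : ℕ) :
    opB q p (Finsupp.single i 1) =
      thetaStar q p i • Finsupp.single i (1 : F) +
        phi q p i • Finsupp.single (i - 1) (1 : F) := by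
  simp [opB, Finsupp.linearCombination_single]

theorem phi_zero (q : Fˣ) (p : Quad F) : phi q p 0 = 0 := by
  simp [phi]

theorem qq_ne {q : Fˣ} (hq : q ^ 4 ≠ 1) : (q : F) ^ 2 - ((q : F)⁻¹) ^ 2 ≠ 0 := by
  intro h
  apply hq
  have h0 := q.ne_zero
  field_simp at h
  ext
  push_cast
  linear_combination h

theorem qp_ne {q : Fˣ} (hq : q ^ 4 ≠ 1) : (q : F) + (q : F)⁻¹ ≠ 0 := by
  intro h
  apply qq_ne hq
  linear_combination ((q : F) - (q : F)⁻¹) * h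

theorem phi_eq (q : Fˣ) (p : Quad F) (i : ℕ) :
    phi q p i = (p.a : F)⁻¹ * (p.b : F)⁻¹ * (p.l : F) * (q : F) *
    ((q : F) ^ i - ((q : F) ^ i)⁻¹) *
    ((p.l : F)⁻¹ * ((q : F) ^ i * (q : F)⁻¹) - (p.l : F) * ((q : F) * ((q : F) ^ i)⁻¹)) *
    (((q : F) ^ i)⁻¹ -
      (p.a : F) * (p.b : F) * (p.c : F) * (p.l : F)⁻¹ * ((q : F) ^ i * (q : F)⁻¹)) *
    (((q : F) ^ i)⁻¹ -
      (p.a : F) * (p.b : F) * (p.c : F)⁻¹ * (p.l : F)⁻¹ * ((q : F) ^ i * (q : F)⁻¹)) := by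
  have h0 := q.ne_zero
  rw [phi, zpow_sub₀ h0, zpow_sub₀ h0, zpow_neg, zpow_natCast, zpow_one, div_eq_mul_inv,
    div_eq_mul_inv]

theorem theta_eq (q : Fˣ) (p : Quad F) (i : ℕ) :
    theta q p i = (p.a : F) * (p.l : F)⁻¹ * ((q : F) ^ i) ^ 2 +
      (p.a : F)⁻¹ * (p.l : F) * (((q : F) ^ i)⁻¹) ^ 2 := by
  have : (-2 * (i : ℤ)) = -((2 * i : ℕ) : ℤ) := by push_cast; ring
  rw [theta, this, zpow_neg, zpow_natCast, mul_comm 2 i, pow_mul, inv_pow]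
  rw [show (2 * (i : ℤ)) = ((i * 2 : ℕ) : ℤ) by push_cast; ring, zpow_natCast, pow_mul]

theorem thetaStar_eq (q : Fˣ) (p : Quad F) (i : ℕ) :
    thetaStar q p i = (p.b : F) * (p.l : F)⁻¹ * ((q : F) ^ i) ^ 2 +
      (p.b : F)⁻¹ * (p.l : F) * (((q : F) ^ i)⁻¹) ^ 2 := by
  have : (-2 * (i : ℤ)) = -((2 * i : ℕ) : ℤ) := by push_cast; ring
  rw [thetaStar, this, zpow_neg, zpow_natCast, mul_comm 2 i, pow_mul, inv_pow]
  rw [show (2 * (i : ℤ)) = ((i * 2 : ℕ) : ℤ) by push_cast; ring, zpow_natCast, pow_mul]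

theorem cas_gamma (q : Fˣ) (p : Quad F) :
    cas q (opC q p) (opA q p) (opB q p) =
      (omegaEps q p * ((q : F) + (q : F)⁻¹)⁻¹) • (1 : Module.End F (ℕ →₀ F)) := by
  rw [cas, opC]
  exact sub_add_cancel (G := Module.End F (ℕ →₀ F)) _ _

set_option linter.unusedSimpArgs false in
theorem cas_alpha {q : Fˣ} (hq : q ^ 4 ≠ 1) (p : Quad F) :
    cas q (opA q p) (opB q p) (opC q p) =
      (omega q p * ((q : F) + (q : F)⁻¹)⁻¹) • (1 : Module.End F (ℕ →₀ F)) := by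
  have h1 := qq_ne hq
  have h2 := qp_ne hq
  obtain ⟨a, b, c, l⟩ := p
  have hq0 := q.ne_zero
  have ha := a.ne_zero
  have hb := b.ne_zero
  have hc := c.ne_zero
  have hl := l.ne_zero
  have h3 : (q : F) ^ 4 - 1 ≠ 0 := by
    intro h
    apply h1
    field_simp
    linear_combination h
  have h4 : (q : F) ^ 2 + 1 ≠ 0 := by
    intro h
    apply h3
    linear_combination ((q : F) ^ 2 - 1) * h
  have e1 : ((q : F) ^ 2 - ((q : F)⁻¹) ^ 2)⁻¹ = (q : F) ^ 2 * ((q : F) ^ 4 - 1)⁻¹ := by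
    field_simp
  have e2 : ((q : F) + (q : F)⁻¹)⁻¹ =
      (q : F) * ((q : F) ^ 2 - 1) * ((q : F) ^ 4 - 1)⁻¹ := by
    have : (q : F) ^ 4 - 1 = ((q : F) ^ 2 - 1) * ((q : F) ^ 2 + 1) := by ring
    have h5 : (q : F) ^ 2 - 1 ≠ 0 := by
      intro h
      apply h3
      rw [this, h, zero_mul]
    rw [this]
    field_simp
  have e3 : ((q : F) ^ 4 - 1)⁻¹ * ((q : F) ^ 4 - 1) = 1 := inv_mul_cancel₀ h3
  refine Finsupp.lhom_ext' fun i => LinearMap.ext_ring ?_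
  simp only [LinearMap.comp_apply, Finsupp.lsingle_apply]
  rw [cas, opC, e1, e2]
  generalize hD : (q : F) ^ 4 - 1 = D at *
  rcases i with _ | _ | n
  · simp only [LinearMap.add_apply, LinearMap.sub_apply, LinearMap.smul_apply,
      Module.End.mul_apply, Module.End.one_apply, map_add, map_sub, map_smul, opA_single,
      opB_single, phi_zero, Nat.zero_add, Nat.add_sub_cancel, zero_smul, add_zero]
    match_scalars
    all_goals
      simp only [theta_eq, thetaStar_eq, phi_eq, omegaEps, omega, pow_succ, pow_zero, one_mul]
      field_simp
      simp only [← hD]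
      ring
  · simp only [LinearMap.add_apply, LinearMap.sub_apply, LinearMap.smul_apply,
      Module.End.mul_apply, Module.End.one_apply, map_add, map_sub, map_smul, opA_single,
      opB_single, phi_zero, Nat.zero_add, Nat.add_sub_cancel, Nat.sub_self, zero_smul, add_zero,
      Nat.reduceAdd, Nat.reduceSub]
    match_scalars
    all_goals
      simp only [theta_eq, thetaStar_eq, phi_eq, omegaEps, omega, pow_succ, pow_zero, one_mul]
      field_simp
      simp only [← hD]
      ring
  · simp only [LinearMap.add_apply, LinearMap.sub_apply, LinearMap.smul_apply,
      Module.End.mul_apply, Module.End.one_apply, map_add, map_sub, map_smul, opA_single,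
      opB_single, Nat.add_sub_cancel]
    have hP : (q : F) ^ n ≠ 0 := pow_ne_zero _ hq0
    match_scalars
    all_goals
      simp only [theta_eq, thetaStar_eq, phi_eq, omegaEps, omega, pow_succ, one_mul]
      generalize (q : F) ^ n = P at *
      field_simp
      simp only [← hD]
      ring

set_option linter.unusedSimpArgs false in
theorem cas_beta {q : Fˣ} (hq : q ^ 4 ≠ 1) (p : Quad F) :
    cas q (opB q p) (opC q p) (opA q p) =
      (omegaStar q p * ((q : F) + (q : F)⁻¹)⁻¹) • (1 : Module.End F (ℕ →₀ F)) := by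
  have h1 := qq_ne hq
  have h2 := qp_ne hq
  obtain ⟨a, b, c, l⟩ := p
  have hq0 := q.ne_zero
  have ha := a.ne_zero
  have hb := b.ne_zero
  have hc := c.ne_zero
  have hl := l.ne_zero
  have h3 : (q : F) ^ 4 - 1 ≠ 0 := by
    intro h
    apply h1
    field_simp
    linear_combination h
  have h4 : (q : F) ^ 2 + 1 ≠ 0 := by
    intro h
    apply h3
    linear_combination ((q : F) ^ 2 - 1) * h
  have e1 : ((q : F) ^ 2 - ((q : F)⁻¹) ^ 2)⁻¹ = (q : F) ^ 2 * ((q : F) ^ 4 - 1)⁻¹ := by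
    field_simp
  have e2 : ((q : F) + (q : F)⁻¹)⁻¹ =
      (q : F) * ((q : F) ^ 2 - 1) * ((q : F) ^ 4 - 1)⁻¹ := by
    have : (q : F) ^ 4 - 1 = ((q : F) ^ 2 - 1) * ((q : F) ^ 2 + 1) := by ring
    have h5 : (q : F) ^ 2 - 1 ≠ 0 := by
      intro h
      apply h3
      rw [this, h, zero_mul]
    rw [this]
    field_simp
  have e3 : ((q : F) ^ 4 - 1)⁻¹ * ((q : F) ^ 4 - 1) = 1 := inv_mul_cancel₀ h3
  refine Finsupp.lhom_ext' fun i => LinearMap.ext_ring ?_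
  simp only [LinearMap.comp_apply, Finsupp.lsingle_apply]
  rw [cas, opC, e1, e2]
  generalize hD : (q : F) ^ 4 - 1 = D at *
  rcases i with _ | _ | n
  · simp only [LinearMap.add_apply, LinearMap.sub_apply, LinearMap.smul_apply,
      Module.End.mul_apply, Module.End.one_apply, map_add, map_sub, map_smul, opA_single,
      opB_single, phi_zero, Nat.zero_add, Nat.add_sub_cancel, zero_smul, add_zero]
    match_scalars
    all_goals
      simp only [theta_eq, thetaStar_eq, phi_eq, omegaEps, omegaStar, pow_succ, pow_zero, one_mul]
      field_simp
      simp only [← hD]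
      ring
  · simp only [LinearMap.add_apply, LinearMap.sub_apply, LinearMap.smul_apply,
      Module.End.mul_apply, Module.End.one_apply, map_add, map_sub, map_smul, opA_single,
      opB_single, phi_zero, Nat.zero_add, Nat.add_sub_cancel, Nat.sub_self, zero_smul, add_zero,
      Nat.reduceAdd, Nat.reduceSub]
    match_scalars
    all_goals
      simp only [theta_eq, thetaStar_eq, phi_eq, omegaEps, omegaStar, pow_succ, pow_zero, one_mul]
      field_simp
      simp only [← hD]
      ring
  · simp only [LinearMap.add_apply, LinearMap.sub_apply, LinearMap.smul_apply,
      Module.End.mul_apply, Module.End.one_apply, map_add, map_sub, map_smul, opA_single,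
      opB_single, Nat.add_sub_cancel]
    have hP : (q : F) ^ n ≠ 0 := pow_ne_zero _ hq0
    match_scalars
    all_goals
      simp only [theta_eq, thetaStar_eq, phi_eq, omegaEps, omegaStar, pow_succ, one_mul]
      generalize (q : F) ^ n = P at *
      field_simp
      simp only [← hD]
      ring

/-- The three operators on the space with basis `m_0, m_1, m_2, …`. -/
def op (q : Fˣ) (p : Quad F) : Gen → Module.End F (ℕ →₀ F)
  | Gen.A => opA q p
  | Gen.B => opB q p
  | Gen.C => opC q p

theorem map_cas (q : Fˣ) {R S : Type*} [Ring R] [Ring S] [Algebra F R] [Algebra F S]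
    (f : R →ₐ[F] S) (X Y Z : R) : f (cas q X Y Z) = cas q (f X) (f Y) (f Z) := by
  simp only [cas, map_add, map_sub, map_smul, map_mul]

theorem lift_cas (q : Fˣ) (p : Quad F) (g h k : Gen) :
    FreeAlgebra.lift F (op q p)
        (cas q (FreeAlgebra.ι F g) (FreeAlgebra.ι F h) (FreeAlgebra.ι F k)) =
      cas q (op q p g) (op q p h) (op q p k) := by
  refine (map_cas q (FreeAlgebra.lift F (op q p)) _ _ _).trans ?_
  simp only [FreeAlgebra.lift_ι_apply]

/-- The representation of the universal Askey-Wilson algebra afforded by the three operators. -/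
def rep {q : Fˣ} (hq : q ^ 4 ≠ 1) (p : Quad F) : UAW q →ₐ[F] Module.End F (ℕ →₀ F) :=
  RingQuot.liftAlgHom F ⟨FreeAlgebra.lift F (op q p), by
    intro x y h
    have key : ∀ (r : F) (T : Module.End F (ℕ →₀ F)), (r • 1) * T = T * (r • 1) := by
      intro r T
      ext
      simp
    cases h with
    | alpha g =>
      rw [map_mul, map_mul, lift_cas]
      exact (congrArg (· * _) (cas_alpha hq p)).trans
        ((key _ _).trans (congrArg (_ * ·) (cas_alpha hq p).symm))
    | beta g =>
      rw [map_mul, map_mul, lift_cas]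
      exact (congrArg (· * _) (cas_beta hq p)).trans
        ((key _ _).trans (congrArg (_ * ·) (cas_beta hq p).symm))
    | gamma g =>
      rw [map_mul, map_mul, lift_cas]
      exact (congrArg (· * _) (cas_gamma q p)).trans
        ((key _ _).trans (congrArg (_ * ·) (cas_gamma q p).symm))⟩

theorem rep_gen {q : Fˣ} (hq : q ^ 4 ≠ 1) (p : Quad F) (g : Gen) :
    rep hq p (gen q g) = op q p g := by
  simp [rep, gen]

theorem rep_cas {q : Fˣ} (hq : q ^ 4 ≠ 1) (p : Quad F) (g h k : Gen) :
    rep hq p (cas q (gen q g) (gen q h) (gen q k)) = cas q (op q p g) (op q p h) (op q p k) := by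
  refine (map_cas (R := UAW q) (S := Module.End F (ℕ →₀ F)) q (rep hq p) _ _ _).trans ?_
  simp only [rep_gen]

/-- The Verma module `M_λ(a, b, c)`: the vector space with basis `m_0, m_1, m_2, …`. -/
def Verma {q : Fˣ} (_ : q ^ 4 ≠ 1) (_ : Quad F) : Type _ := ℕ →₀ F

variable {q : Fˣ} (hq : q ^ 4 ≠ 1) (p : Quad F)

instance : AddCommGroup (Verma hq p) := inferInstanceAs (AddCommGroup (ℕ →₀ F))

instance : Module F (Verma hq p) := inferInstanceAs (Module F (ℕ →₀ F))

/-- The structure of a module over the universal Askey-Wilson algebra on `M_λ(a, b, c)`. -/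
instance : Module (UAW q) (Verma hq p) :=
  letI : Module (Module.End F (ℕ →₀ F)) (Verma hq p) :=
    inferInstanceAs (Module (Module.End F (ℕ →₀ F)) (ℕ →₀ F))
  Module.compHom (Verma hq p) (rep hq p).toRingHom

theorem Verma.smul_def (x : UAW q) (v : Verma hq p) : x • v = rep hq p x v := rfl

instance : IsScalarTower F (UAW q) (Verma hq p) where
  smul_assoc r x v := by
    rw [Verma.smul_def, Verma.smul_def, map_smul]
    rfl

/-- The basis `m_0, m_1, m_2, …` of `M_λ(a, b, c)`. -/
def Verma.m : Module.Basis ℕ F (Verma hq p) := Finsupp.basisSingleOne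

theorem Verma.m_eq (i : ℕ) : Verma.m hq p i = (Finsupp.single i (1 : F) : ℕ →₀ F) := by
  exact congrFun Finsupp.coe_basisSingleOne i

theorem Verma.A_smul_m (i : ℕ) :
    gen q Gen.A • Verma.m hq p i =
      theta q p i • Verma.m hq p i + Verma.m hq p (i + 1) := by
  rw [Verma.smul_def, rep_gen, Verma.m_eq, Verma.m_eq]
  exact opA_single q p i

theorem Verma.B_smul_m_zero :
    gen q Gen.B • Verma.m hq p 0 = thetaStar q p 0 • Verma.m hq p 0 := by
  rw [Verma.smul_def, rep_gen, Verma.m_eq]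
  exact (opB_single q p 0).trans (by rw [phi_zero, zero_smul, add_zero]; rfl)

theorem Verma.B_smul_m_succ (i : ℕ) :
    gen q Gen.B • Verma.m hq p (i + 1) =
      thetaStar q p (i + 1) • Verma.m hq p (i + 1) +
        phi q p (i + 1) • Verma.m hq p i := by
  rw [Verma.smul_def, rep_gen, Verma.m_eq, Verma.m_eq]
  exact opB_single q p (i + 1)

theorem Verma.alpha_smul (v : Verma hq p) : alpha q • v = omega q p • v := by
  have h : rep hq p (alpha q) = omega q p • 1 := by
    rw [alpha, map_smul, rep_cas]
    refine (congrArg (_ • ·) (cas_alpha hq p)).trans ?_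
    rw [smul_smul, mul_comm, mul_assoc, inv_mul_cancel₀ (qp_ne hq), mul_one]
  rw [Verma.smul_def, h]
  rfl

theorem Verma.beta_smul (v : Verma hq p) : beta q • v = omegaStar q p • v := by
  have h : rep hq p (beta q) = omegaStar q p • 1 := by
    rw [beta, map_smul, rep_cas]
    refine (congrArg (_ • ·) (cas_beta hq p)).trans ?_
    rw [smul_smul, mul_comm, mul_assoc, inv_mul_cancel₀ (qp_ne hq), mul_one]
  rw [Verma.smul_def, h]
  rfl

theorem Verma.gamma_smul (v : Verma hq p) : gamma q • v = omegaEps q p • v := by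
  have h : rep hq p (gamma q) = omegaEps q p • 1 := by
    rw [gamma, map_smul, rep_cas]
    refine (congrArg (_ • ·) (cas_gamma q p)).trans ?_
    rw [smul_smul, mul_comm, mul_assoc, inv_mul_cancel₀ (qp_ne hq), mul_one]
  rw [Verma.smul_def, h]
  rfl

/-! ## The quotients `W` -/

/-- For `q` of order `d`, this is `d` if `d` is odd and `d / 2` if `d` is even. -/
def dbar (q : Fˣ) : ℕ := if Odd (orderOf q) then orderOf q else orderOf q / 2

theorem pow_dbar_sq (q : Fˣ) : ((q : F) ^ dbar q) ^ 2 = 1 := by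
  have h : (q ^ dbar q) ^ 2 = 1 := by
    rw [dbar]
    split_ifs with h
    · rw [pow_orderOf_eq_one, one_pow]
    · rw [← pow_mul, Nat.div_mul_cancel (Nat.not_odd_iff_even.mp h).two_dvd, pow_orderOf_eq_one]
  simpa using congrArg Units.val h

theorem theta_dbar (q : Fˣ) (p : Quad F) (i : ℕ) : theta q p (dbar q + i) = theta q p i := by
  simp only [theta_eq, pow_add, mul_inv, mul_pow, inv_pow, pow_dbar_sq, inv_one, one_mul]

theorem thetaStar_dbar (q : Fˣ) (p : Quad F) (i : ℕ) :
    thetaStar q p (dbar q + i) = thetaStar q p i := by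
  simp only [thetaStar_eq, pow_add, mul_inv, mul_pow, inv_pow, pow_dbar_sq, inv_one, one_mul]

theorem phi_dbar (q : Fˣ) (p : Quad F) (i : ℕ) : phi q p (dbar q + i) = phi q p i := by
  rw [phi_eq, phi_eq, pow_add]
  rcases sq_eq_one_iff.mp (pow_dbar_sq q) with h | h
  · rw [h, one_mul]
  · rw [h, neg_one_mul, inv_neg]
    ring

/-- The underlying subspace of `O_λ^δ(a, b, c)`: the span of the vectors
`δ m_i - m_{đ + i}`. -/
def Ospace (δ : F) : Submodule F (Verma hq p) :=
  Submodule.span F (Set.range fun i : ℕ => δ • Verma.m hq p i - Verma.m hq p (dbar q + i))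

theorem smul_comm_scalar (x : UAW q) (r : F) (v : Verma hq p) : x • r • v = r • x • v := by
  rw [Verma.smul_def, Verma.smul_def]
  exact (rep hq p x).map_smul r v

theorem Ospace_of_gen (δ : F) (x : UAW q)
    (h : ∀ i : ℕ, x • (δ • Verma.m hq p i - Verma.m hq p (dbar q + i)) ∈ Ospace hq p δ)
    (v : Verma hq p) (hv : v ∈ Ospace hq p δ) : x • v ∈ Ospace hq p δ := by
  induction hv using Submodule.span_induction with
  | mem v hv => obtain ⟨i, rfl⟩ := hv; exact h i
  | zero => rw [smul_zero]; exact Submodule.zero_mem _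
  | add u v _ _ hu hv => rw [smul_add]; exact Submodule.add_mem _ hu hv
  | smul r v _ hv => rw [smul_comm_scalar]; exact Submodule.smul_mem _ _ hv

theorem Ospace_A (δ : F) (v : Verma hq p) (hv : v ∈ Ospace hq p δ) :
    gen q Gen.A • v ∈ Ospace hq p δ := by
  refine Ospace_of_gen hq p δ _ (fun i => ?_) v hv
  have e : gen q Gen.A • (δ • Verma.m hq p i - Verma.m hq p (dbar q + i)) =
      theta q p i • (δ • Verma.m hq p i - Verma.m hq p (dbar q + i)) +
        (δ • Verma.m hq p (i + 1) - Verma.m hq p (dbar q + (i + 1))) := by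
    rw [smul_sub, smul_comm_scalar, Verma.A_smul_m, Verma.A_smul_m, theta_dbar,
      ← Nat.add_assoc]
    module
  rw [e]
  exact Submodule.add_mem _ (Submodule.smul_mem _ _ (Submodule.subset_span ⟨i, rfl⟩))
    (Submodule.subset_span ⟨i + 1, rfl⟩)

theorem Ospace_B (δ : F) (v : Verma hq p) (hv : v ∈ Ospace hq p δ) :
    gen q Gen.B • v ∈ Ospace hq p δ := by
  refine Ospace_of_gen hq p δ _ (fun i => ?_) v hv
  rcases i with _ | i
  · have e : gen q Gen.B • (δ • Verma.m hq p 0 - Verma.m hq p (dbar q + 0)) =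
        thetaStar q p 0 • (δ • Verma.m hq p 0 - Verma.m hq p (dbar q + 0)) := by
      have e2 : gen q Gen.B • Verma.m hq p (dbar q + 0) =
          thetaStar q p 0 • Verma.m hq p (dbar q + 0) := by
        have h1 := thetaStar_dbar q p 0
        have h2 := phi_dbar q p 0
        rw [phi_zero] at h2
        generalize dbar q + 0 = k at *
        rcases k with _ | k
        · rw [Verma.B_smul_m_zero]
        · rw [Verma.B_smul_m_succ, h1, h2, zero_smul, add_zero]
      rw [smul_sub, smul_comm_scalar, Verma.B_smul_m_zero, e2]
      module
    rw [e]
    exact Submodule.smul_mem _ _ (Submodule.subset_span ⟨0, rfl⟩)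
  · have e : gen q Gen.B • (δ • Verma.m hq p (i + 1) - Verma.m hq p (dbar q + (i + 1))) =
        thetaStar q p (i + 1) •
            (δ • Verma.m hq p (i + 1) - Verma.m hq p (dbar q + (i + 1))) +
          phi q p (i + 1) • (δ • Verma.m hq p i - Verma.m hq p (dbar q + i)) := by
      have h1 := thetaStar_dbar q p (i + 1)
      have h2 := phi_dbar q p (i + 1)
      rw [← Nat.add_assoc] at *
      rw [smul_sub, smul_comm_scalar, Verma.B_smul_m_succ, Verma.B_smul_m_succ, h1, h2]
      module
    rw [e]
    exact Submodule.add_mem _ (Submodule.smul_mem _ _ (Submodule.subset_span ⟨i + 1, rfl⟩))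
      (Submodule.smul_mem _ _ (Submodule.subset_span ⟨i, rfl⟩))

theorem Ospace_C (δ : F) (v : Verma hq p) (hv : v ∈ Ospace hq p δ) :
    gen q Gen.C • v ∈ Ospace hq p δ := by
  have e : gen q Gen.C • v = (omegaEps q p * ((q : F) + (q : F)⁻¹)⁻¹) • v -
      ((q : F) ^ 2 - ((q : F)⁻¹) ^ 2)⁻¹ •
        ((q : F) • (gen q Gen.A • gen q Gen.B • v) -
          (q : F)⁻¹ • (gen q Gen.B • gen q Gen.A • v)) := by
    rw [Verma.smul_def, Verma.smul_def, Verma.smul_def, Verma.smul_def, Verma.smul_def,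
      rep_gen, rep_gen, rep_gen]
    rfl
  rw [e]
  exact Submodule.sub_mem _ (Submodule.smul_mem _ _ hv) (Submodule.smul_mem _ _
    (Submodule.sub_mem _
      (Submodule.smul_mem _ _ (Ospace_A hq p δ _ (Ospace_B hq p δ v hv)))
      (Submodule.smul_mem _ _ (Ospace_B hq p δ _ (Ospace_A hq p δ v hv)))))

/-- The submodule `O_λ^δ(a, b, c)` of `M_λ(a, b, c)`: the linear span of the vectors
`δ m_i - m_{đ + i}`, which is stable under the algebra. -/
def O (δ : F) : Submodule (UAW q) (Verma hq p) where
  carrier := Ospace hq p δ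
  add_mem' := Submodule.add_mem _
  zero_mem' := Submodule.zero_mem _
  smul_mem' x := by
    induction x using UAW.induction with
    | hs r =>
      intro v hv
      rw [algebraMap_smul]
      exact Submodule.smul_mem _ _ hv
    | hg g =>
      intro v hv
      cases g
      · exact Ospace_A hq p δ v hv
      · exact Ospace_B hq p δ v hv
      · exact Ospace_C hq p δ v hv
    | hm x y hx hy =>
      intro v hv
      rw [mul_smul]
      exact hx (hy hv)
    | ha x y hx hy =>
      intro v hv
      rw [add_smul]
      exact Submodule.add_mem _ (hx hv) (hy hv)

/-- The module `W_λ^δ(a, b, c) = M_λ(a, b, c) / O_λ^δ(a, b, c)`. -/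
abbrev W (δ : F) : Type _ := Verma hq p ⧸ O hq p δ

/-- The vector `w_i`, the image of `m_i` in `W_λ^δ(a, b, c)`. -/
def W.w (δ : F) (i : ℕ) : W hq p δ := (O hq p δ).mkQ (Verma.m hq p i)

end Verma

/-- The equivalence of quintuples `(a, b, c, λ, δ)`: the quadruples are equivalent and
`δ + a^đ λ^{-đ} + a^{-đ} λ^đ` agree. -/
def QuintEquiv {F : Type*} [Field F] [IsAlgClosed F] (q : Fˣ) (p : Quad F) (δ : F)
    (p' : Quad F) (δ' : F) : Prop :=
  QuadEquiv q p p' ∧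
    δ + (p.a : F) ^ dbar q * ((p.l : F)⁻¹) ^ dbar q +
        ((p.a : F)⁻¹) ^ dbar q * (p.l : F) ^ dbar q =
      δ' + (p'.a : F) ^ dbar q * ((p'.l : F)⁻¹) ^ dbar q +
        ((p'.a : F)⁻¹) ^ dbar q * (p'.l : F) ^ dbar q

end AskeyWilson

end

/-! Write `y` for the four entries `b c⁻¹ q`, `b c q`, `a⁻¹ λ⁻¹`, `a λ⁻¹` and `m = b λ⁻¹`. The
symmetric group permutes `y` and fixes `m`, and the product of the entries is `(m q)²`. So a class
of quadruples is the same as `m` together with the elementary symmetric functions `e₁, e₂, e₃` of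
`y`.

The Verma module is universal among modules with a vector `v` on which `α, β, γ` act by the given
scalars and for which `B v` and `B A v` are prescribed combinations of `v` and `A v`
(`IsHighestWeight`, `Verma.lift`). Two prescriptions suffice, because eliminating `C` from the
relation for `β` expresses `B A² x` through `B x`, `B A x` and the action of `A`. The six scalars in
these conditions are functions of `m, e₁, e₂, e₃` and determine them (`quadEquiv_iff_sameData`).
Equivalent quadruples thus have the same universal property. Conversely, a homomorphism matching the
generators forces the scalars to agree, since `v` and `A v` are linearly independent in the target.

For the quotients, `m_n` is `∏_{j<n} (A - θ_j)` applied to `m_0`. For `n = đ` this product of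
polynomials plus the constant `a^đ λ^{-đ} + a^{-đ} λ^đ` is one polynomial `T` that does not depend
on the quadruple: it takes the value `t^đ + t^{-đ}` at `t + t⁻¹`. Hence `T(A) w_0 = (δ + a^đ λ^{-đ}
+ a^{-đ} λ^đ) w_0`. This eigenvalue is the extra invariant, and the relation `m_đ = δ m_0` already
generates the submodule that is divided out (`exists_W_hom_iff`). -/

noncomputable section

namespace AskeyWilson

open Polynomial

/-! ### Recovering a family from its multiset of roots. -/

/-- Two families with the same monic polynomial having them as roots differ by a permutation. -/
theorem exists_perm_of_prod_X_sub_C_eq {ι F : Type*} [Fintype ι] [Field F] {y z : ι → F}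
    (h : ∏ i, (X - C (y i)) = ∏ i, (X - C (z i))) : ∃ σ : Equiv.Perm ι, z = y ∘ σ := by
  classical
  have hm : Finset.univ.val.map y = Finset.univ.val.map z := by
    have key : ∀ u : ι → F, (∏ i, (X - C (u i))).roots = Finset.univ.val.map u := by
      intro u
      rw [← roots_multiset_prod_X_sub_C (Finset.univ.val.map u), Multiset.map_map]
      rfl
    rw [← key, ← key, h]
  -- Equal multiplicities give a bijection between the fibres over each value; these glue to the
  -- permutation.
  have e : ∀ c, Nonempty ({i // z i = c} ≃ {i // y i = c}) := by
    intro c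
    refine Fintype.card_eq.mp ?_
    have hc := congrArg (Multiset.count c) hm
    rw [Multiset.count_map, Multiset.count_map] at hc
    rw [Fintype.card_subtype, Fintype.card_subtype]
    simp only [eq_comm (b := c)]
    exact hc.symm
  exact ⟨Equiv.ofFiberEquiv fun c => (e c).some,
    funext fun i => (Equiv.ofFiberEquiv_map (fun c => (e c).some) i).symm⟩

/-! ### The scalars of the action as symmetric functions of the entries. -/

section Symmetric

variable {F : Type*} [Field F]

/-- The four entries of the coordinates of a quadruple. -/
def entries (q : Fˣ) (p : Quad F) (i : Fin 4) : F := ((coord q p).1.1 i : F)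

/-- The monic polynomial whose roots are the four entries. -/
def entriesPoly (q : Fˣ) (p : Quad F) : F[X] := ∏ i, (X - C (entries q p i))

/-- The sum of the entries. -/
def esymmOne (q : Fˣ) (p : Quad F) : F :=
  (p.b : F) * q * (p.c + (p.c : F)⁻¹) + (p.l : F)⁻¹ * (p.a + (p.a : F)⁻¹)

/-- The second elementary symmetric function of the entries. -/
def esymmTwo (q : Fˣ) (p : Quad F) : F :=
  (p.b : F) ^ 2 * q ^ 2 + ((p.l : F)⁻¹) ^ 2 +
    (p.b : F) * q * (p.l : F)⁻¹ * (p.c + (p.c : F)⁻¹) * (p.a + (p.a : F)⁻¹)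

/-- The third elementary symmetric function of the entries. -/
def esymmThree (q : Fˣ) (p : Quad F) : F :=
  (p.b : F) ^ 2 * q ^ 2 * (p.l : F)⁻¹ * (p.a + (p.a : F)⁻¹) +
    ((p.l : F)⁻¹) ^ 2 * p.b * q * (p.c + (p.c : F)⁻¹)

/-- The entries come in two pairs, with products `b² q²` and `λ⁻²`. The constant term depends only
on `b λ⁻¹`, so only three coefficients carry further information. -/
theorem entriesPoly_eq (q : Fˣ) (p : Quad F) :
    entriesPoly q p = X ^ 4 - C (esymmOne q p) * X ^ 3 + C (esymmTwo q p) * X ^ 2 -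
      C (esymmThree q p) * X + C (((p.b * p.l⁻¹ * q : Fˣ) : F) ^ 2) := by
  have h : ∀ y : Fin 4 → F, ∏ i, (X - C (y i)) =
      X ^ 4 - C (y 0 + y 1 + (y 2 + y 3)) * X ^ 3 +
        C (y 0 * y 1 + y 2 * y 3 + (y 0 + y 1) * (y 2 + y 3)) * X ^ 2 -
        C (y 0 * y 1 * (y 2 + y 3) + y 2 * y 3 * (y 0 + y 1)) * X +
        C (y 0 * y 1 * (y 2 * y 3)) := by
    intro y
    simp only [Fin.prod_univ_four, map_add, map_mul]
    ring
  rw [entriesPoly, h]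
  have e0 : entries q p 0 = (p.b : F) * (p.c : F)⁻¹ * q := by
    rw [← Units.val_inv_eq_inv_val]; rfl
  have e1 : entries q p 1 = (p.b : F) * p.c * q := rfl
  have e2 : entries q p 2 = (p.a : F)⁻¹ * (p.l : F)⁻¹ := by
    rw [← Units.val_inv_eq_inv_val, ← Units.val_inv_eq_inv_val]; rfl
  have e3 : entries q p 3 = (p.a : F) * (p.l : F)⁻¹ := by
    rw [← Units.val_inv_eq_inv_val]; rfl
  have ha := p.a.ne_zero
  have hc := p.c.ne_zero
  have hl := p.l.ne_zero
  have s1 : entries q p 0 + entries q p 1 + (entries q p 2 + entries q p 3) =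
      esymmOne q p := by
    rw [esymmOne, e0, e1, e2, e3]; ring
  have s2 : entries q p 0 * entries q p 1 + entries q p 2 * entries q p 3 +
      (entries q p 0 + entries q p 1) * (entries q p 2 + entries q p 3) = esymmTwo q p := by
    rw [esymmTwo, e0, e1, e2, e3]; field_simp; ring
  have s3 : entries q p 0 * entries q p 1 * (entries q p 2 + entries q p 3) +
      entries q p 2 * entries q p 3 * (entries q p 0 + entries q p 1) = esymmThree q p := by
    rw [esymmThree, e0, e1, e2, e3]; field_simp; ring
  have s4 : entries q p 0 * entries q p 1 * (entries q p 2 * entries q p 3) =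
      ((p.b * p.l⁻¹ * q : Fˣ) : F) ^ 2 := by
    rw [e0, e1, e2, e3]; push_cast; field_simp
  rw [s1, s2, s3, s4]

theorem esymm_eq_of_entriesPoly_eq {q : Fˣ} {p p' : Quad F}
    (h : entriesPoly q p = entriesPoly q p') :
    esymmOne q p = esymmOne q p' ∧ esymmTwo q p = esymmTwo q p' ∧
      esymmThree q p = esymmThree q p' := by
  rw [entriesPoly_eq, entriesPoly_eq] at h
  have h1 := congrArg (coeff · 1) h
  have h2 := congrArg (coeff · 2) h
  have h3 := congrArg (coeff · 3) h
  generalize ((p.b * p.l⁻¹ * q : Fˣ) : F) ^ 2 = u at *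
  generalize ((p'.b * p'.l⁻¹ * q : Fˣ) : F) ^ 2 = v at *
  simp [coeff_C, coeff_X_pow] at h1 h2 h3
  exact ⟨h3, h2, h1⟩

/-- The coefficient of `m_0` in `B A m_0`. -/
def phiShift (q : Fˣ) (p : Quad F) : F :=
  phi q p 1 + theta q p 0 * (thetaStar q p 0 - thetaStar q p 1)

theorem thetaStar_zero_eq (q : Fˣ) (p : Quad F) : thetaStar q p 0 =
    ((p.b * p.l⁻¹ : Fˣ) : F) + ((p.b * p.l⁻¹ : Fˣ) : F)⁻¹ := by
  rw [thetaStar_eq]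
  push_cast
  simp only [pow_zero, inv_one, one_pow, mul_one, mul_inv, inv_inv]

theorem thetaStar_one_eq (q : Fˣ) (p : Quad F) : thetaStar q p 1 =
    ((p.b * p.l⁻¹ : Fˣ) : F) * (q : F) ^ 2 + (((p.b * p.l⁻¹ : Fˣ) : F) * (q : F) ^ 2)⁻¹ := by
  rw [thetaStar_eq]
  push_cast
  simp only [pow_one, mul_inv, inv_inv, inv_pow]

variable (q : Fˣ) (p : Quad F)

/-- This formula and the three after it exhibit the scalars as invariants of the symmetric group.
Here `e₁` supplies the terms with `b` and `λ⁻¹`, and `e₃`, after division by `(b λ⁻¹)² q`, those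
with `b⁻¹` and `λ`. -/
theorem omega_eq : omega q p = esymmOne q p * (q : F)⁻¹ +
    esymmThree q p * (((p.b * p.l⁻¹ : Fˣ) : F) ^ 2 * q)⁻¹ := by
  have hq := q.ne_zero
  have ha := p.a.ne_zero
  have hb := p.b.ne_zero
  have hc := p.c.ne_zero
  have hl := p.l.ne_zero
  rw [omega, esymmOne, esymmThree]
  push_cast
  field_simp
  ring

theorem omegaStar_eq : omegaStar q p = (esymmTwo q p + ((p.b * p.l⁻¹ : Fˣ) : F) ^ 2 + q ^ 2) *
    (((p.b * p.l⁻¹ : Fˣ) : F) * q)⁻¹ := by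
  have hq := q.ne_zero
  have ha := p.a.ne_zero
  have hb := p.b.ne_zero
  have hc := p.c.ne_zero
  have hl := p.l.ne_zero
  rw [omegaStar, esymmTwo]
  push_cast
  field_simp
  ring

theorem omegaEps_eq : omegaEps q p = (esymmOne q p + esymmThree q p * ((q : F) ^ 2)⁻¹) *
    ((p.b * p.l⁻¹ : Fˣ) : F)⁻¹ := by
  have hq := q.ne_zero
  have ha := p.a.ne_zero
  have hb := p.b.ne_zero
  have hc := p.c.ne_zero
  have hl := p.l.ne_zero
  rw [omegaEps, esymmOne, esymmThree]
  push_cast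
  field_simp
  ring

/-- Neither `φ_1` nor `θ_0` is symmetric in the entries in general. Using `A m_0` in place of `m_1 =
(A - θ_0) m_0` adds the correction to `φ_1` that makes the result symmetric. -/
theorem phiShift_eq : phiShift q p = ((q : F) - (q : F)⁻¹) * (esymmOne q p - esymmThree q p) *
    (((p.b * p.l⁻¹ : Fˣ) : F) * q)⁻¹ := by
  have hq := q.ne_zero
  have ha := p.a.ne_zero
  have hb := p.b.ne_zero
  have hc := p.c.ne_zero
  have hl := p.l.ne_zero
  rw [phiShift, thetaStar_eq, thetaStar_eq, theta_eq, phi_eq, esymmOne, esymmThree]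
  simp only [pow_zero, pow_one]
  push_cast
  field_simp
  ring

end Symmetric

/-! ### The scalars as a complete set of invariants. -/

section SameData

variable {F : Type*} [Field F] {q : Fˣ} {p p' : Quad F}

/-- Two quadruples have the same data if the scalars that determine the action of the algebra
on the first basis vectors agree. -/
structure SameData (q : Fˣ) (p p' : Quad F) : Prop where
  omega : omega q p = omega q p'
  omegaStar : omegaStar q p = omegaStar q p'
  omegaEps : omegaEps q p = omegaEps q p'
  thetaStar_zero : thetaStar q p 0 = thetaStar q p' 0
  thetaStar_one : thetaStar q p 1 = thetaStar q p' 1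
  phiShift : phiShift q p = phiShift q p'

theorem SameData.symm (h : SameData q p p') : SameData q p' p :=
  ⟨h.1.symm, h.2.symm, h.3.symm, h.4.symm, h.5.symm, h.6.symm⟩

/-- With `m = b λ⁻¹`, the value `θ*_0 = m + m⁻¹` fixes `m` only up to inversion. The combination
`θ*_1 - q⁻² θ*_0 = (q² - q⁻²) m` removes the ambiguity. -/
theorem SameData.ratio_eq (h : SameData q p p') (hq : q ^ 4 ≠ 1) :
    p.b * p.l⁻¹ = p'.b * p'.l⁻¹ := by
  have h0 := h.thetaStar_zero
  have h1 := h.thetaStar_one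
  rw [thetaStar_zero_eq, thetaStar_zero_eq] at h0
  rw [thetaStar_one_eq, thetaStar_one_eq] at h1
  generalize p.b * p.l⁻¹ = x at *
  generalize p'.b * p'.l⁻¹ = y at *
  have hd := qq_ne hq
  have hqz := q.ne_zero
  rw [mul_inv, mul_inv] at h1
  ext
  apply mul_left_cancel₀ hd
  linear_combination h1 - ((q : F)⁻¹) ^ 2 * h0

/-- Once `b λ⁻¹` is known, `omegaStar` gives `e₂`, `omegaEps` gives `e₁ + q⁻² e₃` and `phiShift`
gives `e₁ - e₃`. The last two are independent because `q² + 1 ≠ 0`. -/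
theorem SameData.entriesPoly_eq (h : SameData q p p') (hq : q ^ 4 ≠ 1) :
    entriesPoly q p = entriesPoly q p' := by
  have hx := h.ratio_eq hq
  have hqz := q.ne_zero
  have hm := (p'.b * p'.l⁻¹).ne_zero
  have h2 := h.omegaStar
  have h3 := h.omegaEps
  have h4 := h.phiShift
  rw [omegaStar_eq, omegaStar_eq, hx] at h2
  rw [omegaEps_eq, omegaEps_eq, hx] at h3
  rw [phiShift_eq, phiShift_eq, hx] at h4
  have hq2 : (q : F) ^ 2 + 1 ≠ 0 := by
    intro h
    apply qp_ne hq
    field_simp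
    linear_combination h
  have hqm : (q : F) - (q : F)⁻¹ ≠ 0 := by
    intro h
    apply qq_ne hq
    linear_combination ((q : F) + (q : F)⁻¹) * h
  have h2' := mul_right_cancel₀ (inv_ne_zero (mul_ne_zero hm hqz)) h2
  have h3' := mul_right_cancel₀ (inv_ne_zero hm) h3
  have h4' := mul_left_cancel₀ hqm (mul_right_cancel₀ (inv_ne_zero (mul_ne_zero hm hqz)) h4)
  have e3 : esymmThree q p = esymmThree q p' := by
    have h5 : (q : F) ^ 2 * ((q : F) ^ 2)⁻¹ = 1 := mul_inv_cancel₀ (pow_ne_zero _ hqz)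
    apply mul_left_cancel₀ hq2
    linear_combination (q : F) ^ 2 * (h3' - h4') -
      (esymmThree q p - esymmThree q p') * h5
  rw [AskeyWilson.entriesPoly_eq, AskeyWilson.entriesPoly_eq, hx, e3,
    show esymmTwo q p = esymmTwo q p' by linear_combination h2',
    show esymmOne q p = esymmOne q p' by linear_combination h4' + e3]

theorem sameData_of_entriesPoly_eq (hx : p.b * p.l⁻¹ = p'.b * p'.l⁻¹)
    (h : entriesPoly q p = entriesPoly q p') : SameData q p p' := by
  obtain ⟨h1, h2, h3⟩ := esymm_eq_of_entriesPoly_eq h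
  constructor
  · rw [omega_eq, omega_eq, h1, h3, hx]
  · rw [omegaStar_eq, omegaStar_eq, h2, hx]
  · rw [omegaEps_eq, omegaEps_eq, h1, h3, hx]
  · rw [thetaStar_zero_eq, thetaStar_zero_eq, hx]
  · rw [thetaStar_one_eq, thetaStar_one_eq, hx]
  · rw [phiShift_eq, phiShift_eq, h1, h3, hx]

variable [IsAlgClosed F]

/-- Orbits of a group action coincide as soon as one contains the base point of the other. -/
theorem quadEquiv_iff_exists_perm :
    QuadEquiv q p p' ↔ ∃ σ : Equiv.Perm (Fin 4), coord q p' = permCoord q (coord q p) σ := by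
  have key : ∀ σ : Equiv.Perm (Fin 4), s4Act q p.orb σ = p'.orb ↔
      coord q p' = permCoord q (coord q p) σ := by
    intro σ
    rw [s4Act, Equiv.symm_apply_eq, coordEquiv_orb, coordEquiv_orb, eq_comm]
  simp only [← key]
  constructor
  · intro h
    have h1 : p'.orb ∈ Set.range (s4Act q p'.orb) := ⟨1, s4Act_one q _⟩
    rw [← h] at h1
    exact h1
  · rintro ⟨σ, h⟩
    refine Set.Subset.antisymm ?_ ?_
    · rintro _ ⟨τ, rfl⟩
      exact ⟨σ⁻¹ * τ, by rw [← h, ← s4Act_mul, mul_inv_cancel_left]⟩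
    · rintro _ ⟨τ, rfl⟩
      exact ⟨σ * τ, by rw [← h, ← s4Act_mul]⟩

theorem quadEquiv_iff_sameData (hq : q ^ 4 ≠ 1) : QuadEquiv q p p' ↔ SameData q p p' := by
  rw [quadEquiv_iff_exists_perm]
  constructor
  · rintro ⟨σ, h⟩
    refine sameData_of_entriesPoly_eq (congrArg (fun y => y.1.2) h).symm ?_
    have h1 : entries q p' = entries q p ∘ σ :=
      funext fun i => congrArg (fun y : CoordSpace q => (y.1.1 i : F)) h
    rw [entriesPoly, entriesPoly, h1]
    exact (Equiv.prod_comp σ fun i => X - C (entries q p i)).symm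
  · intro h
    obtain ⟨σ, hσ⟩ := exists_perm_of_prod_X_sub_C_eq (h.entriesPoly_eq hq)
    exact ⟨σ, Subtype.ext (Prod.ext (funext fun i => Units.ext (congrFun hσ i))
      (h.ratio_eq hq).symm)⟩

end SameData

/-! ### Generators and central elements as operators on a module. -/

theorem cas_apply {F V : Type*} [Field F] [AddCommGroup V] [Module F V] {q : Fˣ}
    (X Y Z : Module.End F V) (v : V) : cas q X Y Z v =
    X v + ((q : F) ^ 2 - ((q : F)⁻¹) ^ 2)⁻¹ • ((q : F) • Y (Z v) - (q : F)⁻¹ • Z (Y v)) := rfl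

section Act

variable {F : Type*} [Field F] (q : Fˣ) (V : Type*) [AddCommGroup V] [Module F V]
  [Module (UAW q) V] [IsScalarTower F (UAW q) V]

/-- The operator by which a generator acts on a module. -/
def act (g : Gen) : Module.End F V := Algebra.lsmul F F V (gen q g)

variable {q V}

theorem gen_smul_eq_act (g : Gen) (v : V) : gen q g • v = act q V g v := rfl

theorem cas_smul (g h k : Gen) (v : V) : cas q (gen q g) (gen q h) (gen q k) • v =
    cas q (act q V g) (act q V h) (act q V k) v :=
  LinearMap.congr_fun (map_cas q (Algebra.lsmul F F V) (gen q g) (gen q h) (gen q k)) v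

theorem beta_smul_eq (v : V) : beta q • v =
    ((q : F) + (q : F)⁻¹) • cas q (act q V Gen.B) (act q V Gen.C) (act q V Gen.A) v := by
  rw [beta, smul_assoc, cas_smul]

theorem gamma_smul_eq (v : V) : gamma q • v =
    ((q : F) + (q : F)⁻¹) • cas q (act q V Gen.C) (act q V Gen.A) (act q V Gen.B) v := by
  rw [gamma, smul_assoc, cas_smul]

variable (q)

theorem beta_mul_gen (g : Gen) : beta q * gen q g = gen q g * beta q := by
  have h := RingQuot.mkAlgHom_rel F (Rel.beta (q := q) g)
  rw [map_mul, map_mul, map_cas] at h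
  rw [beta, smul_mul_assoc, mul_smul_comm]
  exact congrArg (_ • ·) h

theorem gamma_mul_gen (g : Gen) : gamma q * gen q g = gen q g * gamma q := by
  have h := RingQuot.mkAlgHom_rel F (Rel.gamma (q := q) g)
  rw [map_mul, map_mul, map_cas] at h
  rw [gamma, smul_mul_assoc, mul_smul_comm]
  exact congrArg (_ • ·) h

end Act

/-! ### Eliminating `C`: the recursion for `B` along powers of `A`. -/

section Intertwine

variable {F : Type*} [Field F] {q : Fˣ} {M V : Type*} [AddCommGroup M] [Module F M]
  [AddCommGroup V] [Module F V]

/-- One of the Askey-Wilson relations, obtained by eliminating `C`. -/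
theorem cas_elimination {A B C : Module.End F V} {μ ν : F} {x : V}
    (hβ : cas q B C A x = μ • x) (hγ : cas q C A B x = ν • x)
    (hγ' : cas q C A B (A x) = ν • A x) :
    ((((q : F) ^ 2 - ((q : F)⁻¹) ^ 2)⁻¹) ^ 2 * q * (q : F)⁻¹) • B (A (A x)) =
      μ • x - B x - ((((q : F) ^ 2 - ((q : F)⁻¹) ^ 2)⁻¹) * ((q : F) - (q : F)⁻¹) * ν) • A x +
      ((((q : F) ^ 2 - ((q : F)⁻¹) ^ 2)⁻¹) ^ 2 * ((q : F) ^ 2 + ((q : F)⁻¹) ^ 2)) • A (B (A x)) -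
      ((((q : F) ^ 2 - ((q : F)⁻¹) ^ 2)⁻¹) ^ 2 * q * (q : F)⁻¹) • A (A (B x)) := by
  rw [cas_apply] at hβ hγ hγ'
  rw [← eq_sub_iff_add_eq] at hγ hγ'
  rw [hγ, hγ'] at hβ
  simp only [map_sub, map_smul] at hβ
  rw [← hβ]
  -- The identity is polynomial in `q`, `q⁻¹` and `(q² - q⁻²)⁻¹` as independent letters; this is why
  -- the coefficient `q * q⁻¹` is left unsimplified.
  generalize ((q : F) ^ 2 - ((q : F)⁻¹) ^ 2)⁻¹ = κ
  generalize (q : F)⁻¹ = r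
  module

/-- A linear map that intertwines `A` and, at the vectors `x` and `A x`, also `B`,
intertwines `B` at `A (A x)`. -/
theorem intertwines_at_sq (hq : q ^ 4 ≠ 1) {A B C : Module.End F M} {A' B' C' : Module.End F V}
    (f : M →ₗ[F] V) (hA : ∀ x, f (A x) = A' (f x)) {μ ν : F} {x : M}
    (hβ : cas q B C A x = μ • x) (hγ : cas q C A B x = ν • x)
    (hγA : cas q C A B (A x) = ν • A x)
    (hβ' : cas q B' C' A' (f x) = μ • f x) (hγ' : cas q C' A' B' (f x) = ν • f x)
    (hγA' : cas q C' A' B' (A' (f x)) = ν • A' (f x))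
    (h0 : f (B x) = B' (f x)) (h1 : f (B (A x)) = B' (f (A x))) :
    f (B (A (A x))) = B' (f (A (A x))) := by
  have h := congrArg f (cas_elimination hβ hγ hγA)
  have h' := cas_elimination hβ' hγ' hγA'
  simp only [map_sub, map_add, map_smul, hA, h0, h1] at h
  rw [← h'] at h
  rw [hA, hA]
  -- The coefficient of `B A² x` is invertible, so the relation can be solved for that vector in
  -- both modules.
  have hk : (((q : F) ^ 2 - ((q : F)⁻¹) ^ 2)⁻¹) ^ 2 * q * (q : F)⁻¹ ≠ 0 :=
    mul_ne_zero (mul_ne_zero (pow_ne_zero _ (inv_ne_zero (qq_ne hq))) q.ne_zero)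
      (inv_ne_zero q.ne_zero)
  exact smul_right_injective V hk h

end Intertwine

/-! ### The universal property of the Verma module. -/

section HighestWeight

variable {F : Type*} [Field F] {q : Fˣ} {V : Type*} [AddCommGroup V] [Module F V]
  [Module (UAW q) V] [IsScalarTower F (UAW q) V]
  {V' : Type*} [AddCommGroup V'] [Module F V'] [Module (UAW q) V'] [IsScalarTower F (UAW q) V']

/-- The relations satisfied by the first basis vector of the Verma module of `p`. -/
structure IsHighestWeight (p : Quad F) (v : V) : Prop where
  alpha_smul : alpha q • v = omega q p • v
  beta_smul : beta q • v = omegaStar q p • v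
  gamma_smul : gamma q • v = omegaEps q p • v
  B_smul : gen q Gen.B • v = thetaStar q p 0 • v
  B_smul_A_smul : gen q Gen.B • gen q Gen.A • v =
    thetaStar q p 1 • gen q Gen.A • v + phiShift q p • v

omit [IsScalarTower F (UAW q) V] in
theorem IsHighestWeight.of_sameData {p p' : Quad F} {v : V} (h : IsHighestWeight (q := q) p v)
    (hd : SameData q p p') : IsHighestWeight (q := q) p' v :=
  ⟨by rw [h.alpha_smul, hd.omega], by rw [h.beta_smul, hd.omegaStar],
    by rw [h.gamma_smul, hd.omegaEps], by rw [h.B_smul, hd.thetaStar_zero],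
    by rw [h.B_smul_A_smul, hd.thetaStar_one, hd.phiShift]⟩

theorem IsHighestWeight.map {p : Quad F} {v : V} (h : IsHighestWeight (q := q) p v)
    (f : V →ₗ[UAW q] V') : IsHighestWeight (q := q) p (f v) := by
  have hf : ∀ (r : F) (x : V), f (r • x) = r • f x := fun r x => f.map_smul_of_tower r x
  constructor
  · rw [← map_smul, h.alpha_smul, hf]
  · rw [← map_smul, h.beta_smul, hf]
  · rw [← map_smul, h.gamma_smul, hf]
  · rw [← map_smul, h.B_smul, hf]
  · rw [← map_smul, ← map_smul, h.B_smul_A_smul, map_add, hf, hf]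

-- Independence of `v` and `A v` allows the two coefficients of `B A v` to be compared separately;
-- the other scalars need only `v ≠ 0`.
omit [IsScalarTower F (UAW q) V] in
theorem IsHighestWeight.sameData {p p' : Quad F} {v : V} (h : IsHighestWeight (q := q) p v)
    (h' : IsHighestWeight (q := q) p' v)
    (hv : LinearIndependent F ![v, gen q Gen.A • v]) : SameData q p p' := by
  have hv0 : v ≠ 0 := hv.ne_zero 0
  have e := h.B_smul_A_smul.symm.trans h'.B_smul_A_smul
  rw [LinearIndependent.pair_iff] at hv
  obtain ⟨e0, e1⟩ := hv (phiShift q p - phiShift q p') (thetaStar q p 1 - thetaStar q p' 1) (by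
    rw [sub_smul, sub_smul, sub_add_sub_comm, add_comm (phiShift q p • v), e,
      add_comm (phiShift q p' • v), sub_self])
  exact ⟨smul_left_injective F hv0 (h.alpha_smul.symm.trans h'.alpha_smul),
    smul_left_injective F hv0 (h.beta_smul.symm.trans h'.beta_smul),
    smul_left_injective F hv0 (h.gamma_smul.symm.trans h'.gamma_smul),
    smul_left_injective F hv0 (h.B_smul.symm.trans h'.B_smul), sub_eq_zero.mp e1,
    sub_eq_zero.mp e0⟩

variable (hq : q ^ 4 ≠ 1) (p : Quad F)

theorem Verma.isHighestWeight : IsHighestWeight (q := q) p (Verma.m hq p 0) where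
  alpha_smul := Verma.alpha_smul hq p _
  beta_smul := Verma.beta_smul hq p _
  gamma_smul := Verma.gamma_smul hq p _
  B_smul := Verma.B_smul_m_zero hq p
  B_smul_A_smul := by
    rw [Verma.A_smul_m, smul_add, smul_comm (gen q Gen.B) (theta q p 0), Verma.B_smul_m_zero,
      Verma.B_smul_m_succ, phiShift]
    module

/-- The image of `m_i` under the homomorphism from a Verma module sending `m_0` to `v`. -/
def descent (q : Fˣ) [Module (UAW q) V] (p : Quad F) (v : V) : ℕ → V
  | 0 => v
  | i + 1 => gen q Gen.A • descent q p v i - theta q p i • descent q p v i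

/-- The linear map underlying the homomorphism from a Verma module sending `m_0` to `v`. -/
def Verma.liftLinear (v : V) : Verma hq p →ₗ[F] V :=
  (Verma.m hq p).constr F (descent q p v)

omit [IsScalarTower F (UAW q) V] in
theorem Verma.liftLinear_m (v : V) (i : ℕ) :
    Verma.liftLinear hq p v (Verma.m hq p i) = descent q p v i :=
  (Verma.m hq p).constr_basis F _ i

/-- This holds for every `v`: the recursion for `descent` is the action of `A` on the `m_i`, solved
for `m_{i+1}`. -/
theorem Verma.liftLinear_A (v : V) (x : Verma hq p) :
    Verma.liftLinear hq p v (gen q Gen.A • x) = gen q Gen.A • Verma.liftLinear hq p v x := by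
  have h : Verma.liftLinear hq p v ∘ₗ act q (Verma hq p) Gen.A =
      act q V Gen.A ∘ₗ Verma.liftLinear hq p v := by
    refine (Verma.m hq p).ext fun i => ?_
    rw [LinearMap.comp_apply, LinearMap.comp_apply, ← gen_smul_eq_act, ← gen_smul_eq_act,
      Verma.A_smul_m, map_add, map_smul, Verma.liftLinear_m, Verma.liftLinear_m, descent]
    abel
  exact LinearMap.congr_fun h x

/-- The image is spanned by vectors obtained from `v` by applying `A` and scalars, so an element
commuting with `A` acts on all of it as it does on `v`. It is applied to `β` and `γ`. -/
theorem Verma.liftLinear_smul_of_commute {v : V} {z : UAW q} {r : F} (hv : z • v = r • v)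
    (hz : z * gen q Gen.A = gen q Gen.A * z) (x : Verma hq p) :
    z • Verma.liftLinear hq p v x = r • Verma.liftLinear hq p v x := by
  have h : Algebra.lsmul F F V z ∘ₗ Verma.liftLinear hq p v = r • Verma.liftLinear hq p v := by
    refine (Verma.m hq p).ext fun i => ?_
    rw [LinearMap.comp_apply, LinearMap.smul_apply, Verma.liftLinear_m]
    change z • descent q p v i = r • descent q p v i
    induction i with
    | zero => exact hv
    | succ i ih =>
      rw [descent, smul_sub, smul_sub, smul_comm z (theta q p i), ← mul_smul, hz, mul_smul, ih,
        smul_comm r, smul_comm r]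
  exact LinearMap.congr_fun h x

variable {hq p}

/-- The highest-weight conditions say that `B` is intertwined at `m_0` and at `A m_0`. The step from
`x`, `A x` to `A² x` then carries this to all `m_i`, the induction hypothesis being about the pair
`m_i`, `A m_i`. -/
theorem IsHighestWeight.liftLinear_B {v : V} (hv : IsHighestWeight (q := q) p v)
    (x : Verma hq p) :
    Verma.liftLinear hq p v (gen q Gen.B • x) = gen q Gen.B • Verma.liftLinear hq p v x := by
  have hs : (q : F) + (q : F)⁻¹ ≠ 0 := qp_ne hq
  have hβ : ∀ y : Verma hq p,
      cas q (act q (Verma hq p) Gen.B) (act q (Verma hq p) Gen.C) (act q (Verma hq p) Gen.A) y =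
        (((q : F) + (q : F)⁻¹)⁻¹ * omegaStar q p) • y := fun y => by
    rw [mul_smul, ← Verma.beta_smul, beta_smul_eq, inv_smul_smul₀ hs]
  have hγ : ∀ y : Verma hq p,
      cas q (act q (Verma hq p) Gen.C) (act q (Verma hq p) Gen.A) (act q (Verma hq p) Gen.B) y =
        (((q : F) + (q : F)⁻¹)⁻¹ * omegaEps q p) • y := fun y => by
    rw [mul_smul, ← Verma.gamma_smul, gamma_smul_eq, inv_smul_smul₀ hs]
  have hβ' : ∀ y, cas q (act q V Gen.B) (act q V Gen.C) (act q V Gen.A)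
      (Verma.liftLinear hq p v y) =
        (((q : F) + (q : F)⁻¹)⁻¹ * omegaStar q p) • Verma.liftLinear hq p v y := fun y => by
    rw [mul_smul, ← Verma.liftLinear_smul_of_commute hq p hv.beta_smul (beta_mul_gen q _),
      beta_smul_eq, inv_smul_smul₀ hs]
  have hγ' : ∀ y, cas q (act q V Gen.C) (act q V Gen.A) (act q V Gen.B)
      (Verma.liftLinear hq p v y) =
        (((q : F) + (q : F)⁻¹)⁻¹ * omegaEps q p) • Verma.liftLinear hq p v y := fun y => by
    rw [mul_smul, ← Verma.liftLinear_smul_of_commute hq p hv.gamma_smul (gamma_mul_gen q _),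
      gamma_smul_eq, inv_smul_smul₀ hs]
  have hA := Verma.liftLinear_A hq p v
  -- the vectors at which `B` is intertwined
  let S : Submodule F (Verma hq p) := LinearMap.eqLocus
    (Verma.liftLinear hq p v ∘ₗ act q (Verma hq p) Gen.B)
    (act q V Gen.B ∘ₗ Verma.liftLinear hq p v)
  have hAA : ∀ y ∈ S, gen q Gen.A • y ∈ S → gen q Gen.A • gen q Gen.A • y ∈ S := by
    intro y h0 h1
    have hγA' := hγ' (gen q Gen.A • y)
    rw [hA] at hγA'
    exact intertwines_at_sq hq (Verma.liftLinear hq p v) hA (hβ y) (hγ y) (hγ _) (hβ' y)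
      (hγ' y) hγA' h0 h1
  have hsucc : ∀ i, Verma.m hq p (i + 1) =
      gen q Gen.A • Verma.m hq p i - theta q p i • Verma.m hq p i := fun i => by
    rw [Verma.A_smul_m, add_sub_cancel_left]
  have h0 : Verma.m hq p 0 ∈ S := by
    change Verma.liftLinear hq p v (gen q Gen.B • _) = gen q Gen.B • _
    rw [Verma.B_smul_m_zero, map_smul, Verma.liftLinear_m, descent, hv.B_smul]
  have h1 : gen q Gen.A • Verma.m hq p 0 ∈ S := by
    change Verma.liftLinear hq p v (gen q Gen.B • _) = gen q Gen.B • _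
    rw [(Verma.isHighestWeight hq p).B_smul_A_smul, map_add, LinearMap.map_smul, LinearMap.map_smul, hA,
      Verma.liftLinear_m, descent, hv.B_smul_A_smul]
  have hall : ∀ i, Verma.m hq p i ∈ S ∧ gen q Gen.A • Verma.m hq p i ∈ S := by
    intro i
    induction i with
    | zero => exact ⟨h0, h1⟩
    | succ i ih =>
      rw [hsucc, smul_sub, smul_comm (gen q Gen.A) (theta q p i)]
      exact ⟨S.sub_mem ih.2 (S.smul_mem _ ih.1),
        S.sub_mem (hAA _ ih.1 ih.2) (S.smul_mem _ ih.2)⟩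
  have hS : Verma.liftLinear hq p v ∘ₗ act q (Verma hq p) Gen.B =
      act q V Gen.B ∘ₗ Verma.liftLinear hq p v :=
    (Verma.m hq p).ext fun i => (hall i).1
  exact LinearMap.congr_fun hS x

/-- On both sides `γ` is the same scalar, and its definition expresses `C` through `A`, `B` and `γ`.
-/
theorem IsHighestWeight.liftLinear_C {v : V} (hv : IsHighestWeight (q := q) p v)
    (x : Verma hq p) :
    Verma.liftLinear hq p v (gen q Gen.C • x) = gen q Gen.C • Verma.liftLinear hq p v x := by
  have h := congrArg (Verma.liftLinear hq p v) (Verma.gamma_smul hq p x)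
  have h' := Verma.liftLinear_smul_of_commute hq p hv.gamma_smul (gamma_mul_gen q _) x
  rw [gamma_smul_eq, cas_apply, map_smul] at h
  rw [gamma_smul_eq, cas_apply] at h'
  rw [map_smul, ← h'] at h
  have h2 := smul_right_injective V (qp_ne hq) h
  simp only [← gen_smul_eq_act, map_add, map_sub, map_smul, Verma.liftLinear_A,
    hv.liftLinear_B] at h2
  exact add_right_cancel h2

/-- The universal property of the Verma module. -/
def Verma.lift {v : V} (hv : IsHighestWeight (q := q) p v) : Verma hq p →ₗ[UAW q] V where
  toFun := Verma.liftLinear hq p v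
  map_add' := map_add _
  map_smul' x := by
    induction x using UAW.induction with
    | hs r =>
      intro y
      rw [algebraMap_smul, map_smul, RingHom.id_apply, algebraMap_smul]
    | hg g =>
      intro y
      cases g
      · exact Verma.liftLinear_A hq p v y
      · exact hv.liftLinear_B y
      · exact hv.liftLinear_C y
    | hm x z hx hz =>
      intro y
      rw [mul_smul, hx, hz]
      simp only [RingHom.id_apply, mul_smul]
    | ha x z hx hz =>
      intro y
      rw [add_smul, map_add, hx, hz]
      simp only [RingHom.id_apply, add_smul]

theorem Verma.lift_m_zero {v : V} (hv : IsHighestWeight (q := q) p v) :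
    Verma.lift (hq := hq) hv (Verma.m hq p 0) = v :=
  Verma.liftLinear_m hq p v 0

/-- The vector `m_0` generates the module, already under `A` alone. -/
theorem Verma.hom_ext {f g : Verma hq p →ₗ[UAW q] V}
    (h : f (Verma.m hq p 0) = g (Verma.m hq p 0)) : f = g := by
  have hb : ∀ i, f (Verma.m hq p i) = g (Verma.m hq p i) := by
    intro i
    induction i with
    | zero => exact h
    | succ i ih =>
      have hs : Verma.m hq p (i + 1) =
          gen q Gen.A • Verma.m hq p i - theta q p i • Verma.m hq p i := by
        rw [Verma.A_smul_m, add_sub_cancel_left]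
      rw [hs, map_sub, map_sub, map_smul, f.map_smul_of_tower, map_smul, g.map_smul_of_tower, ih]
  have hl : f.restrictScalars F = g.restrictScalars F := (Verma.m hq p).ext hb
  exact LinearMap.ext fun x => LinearMap.congr_fun hl x

end HighestWeight

/-! ### The order of `q²`. -/

section Dbar

variable {F : Type*} [Field F] {q : Fˣ}

theorem orderOf_sq_eq_dbar (q : Fˣ) : orderOf (q ^ 2) = dbar q := by
  rw [orderOf_pow' q two_ne_zero, dbar]
  split_ifs with h
  · rw [Nat.Coprime.gcd_eq_one (Nat.coprime_two_right.mpr h), Nat.div_one]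
  · rw [Nat.gcd_eq_right (Nat.not_odd_iff_even.mp h).two_dvd]

theorem isPrimitiveRoot_sq (q : Fˣ) : IsPrimitiveRoot ((q : F) ^ 2) (dbar q) := by
  have h := IsPrimitiveRoot.orderOf (q ^ 2)
  rw [orderOf_sq_eq_dbar, ← IsPrimitiveRoot.coe_units_iff] at h
  simpa using h

/-- If `q²` had order one, then `q⁴ = 1`. The bound keeps `w_0` and `w_1` independent in the
quotient. -/
theorem one_lt_dbar (hq : q ^ 4 ≠ 1) (hroot : IsOfFinOrder q) : 1 < dbar q := by
  have h0 : 0 < dbar q := by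
    rw [← orderOf_sq_eq_dbar]
    exact (hroot.pow (n := 2)).orderOf_pos
  have h1 : dbar q ≠ 1 := by
    intro h
    rw [← orderOf_sq_eq_dbar, orderOf_eq_one_iff] at h
    exact hq (by rw [show 4 = 2 * 2 from rfl, pow_mul, h, one_pow])
  omega

end Dbar

/-! ### The polynomial in `A` common to all quadruples. -/

section ThetaPoly

variable {F : Type*} [Field F]

/-- Each factor is `t⁻¹ (t - z)(t - z⁻¹)` with `z = y ζ^j`. The products over `j` are `t^n - y^n`
and, since `ζ⁻¹` is primitive too, `t^n - y^{-n}`. -/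
theorem prod_sub_eq_of_isPrimitiveRoot {ζ : F} {n : ℕ} (hζ : IsPrimitiveRoot ζ n) (hn : 0 < n)
    {t y : F} (ht : t ≠ 0) (hy : y ≠ 0) :
    ∏ j ∈ Finset.range n, (t + t⁻¹ - (y * ζ ^ j + y⁻¹ * (ζ⁻¹) ^ j)) =
      t ^ n + (t⁻¹) ^ n - (y ^ n + (y⁻¹) ^ n) := by
  have h1 := congrArg (eval t) (X_pow_sub_C_eq_prod hζ hn (α := y) rfl)
  have h2 := congrArg (eval t) (X_pow_sub_C_eq_prod hζ.inv hn (α := y⁻¹) rfl)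
  simp only [eval_sub, eval_pow, eval_X, eval_C, eval_prod] at h1 h2
  have hζ0 : ζ ≠ 0 := hζ.ne_zero hn.ne'
  have hf : ∀ j, t + t⁻¹ - (y * ζ ^ j + y⁻¹ * (ζ⁻¹) ^ j) =
      t⁻¹ * ((t - ζ ^ j * y) * (t - (ζ⁻¹) ^ j * y⁻¹)) := by
    intro j
    have := pow_ne_zero j hζ0
    rw [inv_pow]
    field_simp
    ring
  rw [Finset.prod_congr rfl fun j _ => hf j, Finset.prod_mul_distrib, Finset.prod_mul_distrib,
    ← h1, ← h2, Finset.prod_const, Finset.card_range, inv_pow, inv_pow]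
  have := pow_ne_zero n ht
  have := pow_ne_zero n hy
  field_simp
  ring

/-- The scalar `a^đ λ^{-đ} + a^{-đ} λ^đ`. -/
def powerTrace (q : Fˣ) (p : Quad F) : F :=
  (p.a : F) ^ dbar q * ((p.l : F)⁻¹) ^ dbar q + ((p.a : F)⁻¹) ^ dbar q * (p.l : F) ^ dbar q

/-- The polynomial `∏_{j < n} (X - θ_j)`. -/
def thetaPoly (q : Fˣ) (p : Quad F) (n : ℕ) : F[X] :=
  ∏ j ∈ Finset.range n, (X - C (theta q p j))

/-- Such a `t` is a root of `X² - x X + 1`, nonzero because the constant term is `1`. -/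
theorem exists_add_inv_eq [IsAlgClosed F] (x : F) : ∃ t : F, t ≠ 0 ∧ t + t⁻¹ = x := by
  have hd : (X ^ 2 - C x * X + 1 : F[X]).degree = 2 := by compute_degree!
  obtain ⟨t, ht⟩ := IsAlgClosed.exists_root (X ^ 2 - C x * X + 1 : F[X]) (by rw [hd]; norm_num)
  simp only [IsRoot, eval_add, eval_sub, eval_pow, eval_mul, eval_X, eval_C, eval_one] at ht
  have h0 : t ≠ 0 := by
    rintro rfl
    simp at ht
  refine ⟨t, h0, ?_⟩
  field_simp
  linear_combination ht

theorem eval_thetaPoly_dbar {q : Fˣ} (hroot : 0 < dbar q) (p : Quad F) {t : F} (ht : t ≠ 0) :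
    (thetaPoly q p (dbar q)).eval (t + t⁻¹) + powerTrace q p =
      t ^ dbar q + (t⁻¹) ^ dbar q := by
  have hy : (p.a : F) * (p.l : F)⁻¹ ≠ 0 := mul_ne_zero p.a.ne_zero (inv_ne_zero p.l.ne_zero)
  have h := prod_sub_eq_of_isPrimitiveRoot (isPrimitiveRoot_sq q) hroot ht hy
  rw [thetaPoly, eval_prod, powerTrace]
  simp only [eval_sub, eval_X, eval_C, theta_eq]
  simp only [mul_inv, inv_inv, mul_pow, ← inv_pow] at h
  simp only [← inv_pow, pow_right_comm _ _ 2]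
  rw [h]
  ring

/-- Both sides take the value `t^đ + t^{-đ}` at `t + t⁻¹`, and every scalar of the infinite field
has that form. -/
theorem thetaPoly_add_powerTrace [IsAlgClosed F] {q : Fˣ} (hroot : 0 < dbar q)
    (p p' : Quad F) : thetaPoly q p (dbar q) + C (powerTrace q p) =
      thetaPoly q p' (dbar q) + C (powerTrace q p') := by
  have := IsAlgClosed.instInfinite (K := F)
  refine Polynomial.funext fun x => ?_
  obtain ⟨t, ht, rfl⟩ := exists_add_inv_eq x
  rw [eval_add, eval_add, eval_C, eval_C, eval_thetaPoly_dbar hroot p ht,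
    eval_thetaPoly_dbar hroot p' ht]

end ThetaPoly

/-! ### The quotients `W`: the relation at `đ`, independence, and factoring maps. -/

section Quotient

variable {F : Type*} [Field F] {q : Fˣ} (hq : q ^ 4 ≠ 1) (p : Quad F)

theorem Verma.m_succ (i : ℕ) : Verma.m hq p (i + 1) =
    gen q Gen.A • Verma.m hq p i - theta q p i • Verma.m hq p i := by
  rw [Verma.A_smul_m, add_sub_cancel_left]

theorem aeval_thetaPoly_smul (n : ℕ) :
    aeval (gen q Gen.A) (thetaPoly q p n) • Verma.m hq p 0 = Verma.m hq p n := by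
  induction n with
  | zero => rw [thetaPoly, Finset.prod_range_zero, map_one, one_smul]
  | succ n ih =>
    rw [thetaPoly, Finset.prod_range_succ, mul_comm, map_mul, mul_smul]
    refine (congrArg (_ • ·) ih).trans ?_
    change aeval (gen q Gen.A) (X - C (theta q p n)) • Verma.m hq p n = _
    rw [map_sub, aeval_X, aeval_C, sub_smul, algebraMap_smul, Verma.m_succ]

variable (δ : F)

theorem W.isHighestWeight : IsHighestWeight (q := q) p (W.w hq p δ 0) :=
  (Verma.isHighestWeight hq p).map (O hq p δ).mkQ

theorem W.w_dbar : W.w hq p δ (dbar q) = δ • W.w hq p δ 0 := by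
  have h : δ • Verma.m hq p 0 - Verma.m hq p (dbar q) ∈ O hq p δ :=
    Submodule.subset_span ⟨0, rfl⟩
  rw [← Submodule.Quotient.mk_eq_zero] at h
  exact (sub_eq_zero.mp h).symm

/-- The polynomial on the left does not depend on `p`, so the scalar on the right is an invariant of
the module with its generator. -/
theorem W.aeval_smul :
    aeval (gen q Gen.A) (thetaPoly q p (dbar q) + C (powerTrace q p)) • W.w hq p δ 0 =
      (δ + powerTrace q p) • W.w hq p δ 0 := by
  rw [map_add, aeval_C, add_smul, algebraMap_smul, add_smul, ← W.w_dbar]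
  congr 1
  exact congrArg (O hq p δ).mkQ (aeval_thetaPoly_smul hq p (dbar q))

/-- The linear form with value `δ ^ j` at `m_{k + j đ}` and zero at the other basis vectors. -/
def residueForm (k : ℕ) : Verma hq p →ₗ[F] F :=
  (Verma.m hq p).constr F fun i => if i % dbar q = k then δ ^ (i / dbar q) else 0

theorem residueForm_m (k i : ℕ) : residueForm hq p δ k (Verma.m hq p i) =
    if i % dbar q = k then δ ^ (i / dbar q) else 0 :=
  (Verma.m hq p).constr_basis F _ i

/-- Shifting an index by `đ` preserves its residue and raises the quotient by one, which costs
exactly the factor `δ`. -/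
theorem residueForm_eq_zero (hd : 0 < dbar q) (k : ℕ) {v : Verma hq p} (hv : v ∈ O hq p δ) :
    residueForm hq p δ k v = 0 := by
  have h : Ospace hq p δ ≤ LinearMap.ker (residueForm hq p δ k) := by
    refine Submodule.span_le.mpr ?_
    rintro _ ⟨i, rfl⟩
    change residueForm hq p δ k (_ - _) = 0
    rw [map_sub, map_smul, residueForm_m, residueForm_m, Nat.add_mod_left,
      Nat.add_div_left _ hd]
    split_ifs
    · rw [smul_eq_mul, pow_succ', sub_self]
    · rw [smul_zero, sub_self]
  exact h hv

/-- The residue forms for `0` and `1` descend to the quotient and separate `w_0` from `w_1`; the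
residues are distinct because `1 < đ`. -/
theorem W.linearIndependent (hd : 1 < dbar q) :
    LinearIndependent F ![W.w hq p δ 0, gen q Gen.A • W.w hq p δ 0] := by
  rw [LinearIndependent.pair_iff]
  intro r s h
  have hm : r • Verma.m hq p 0 + s • gen q Gen.A • Verma.m hq p 0 ∈ O hq p δ :=
    (Submodule.Quotient.mk_eq_zero _).mp h
  rw [Verma.A_smul_m] at hm
  have h0 := residueForm_eq_zero hq p δ (by omega) 0 hm
  have h1 := residueForm_eq_zero hq p δ (by omega) 1 hm
  simp only [map_add, map_smul, residueForm_m, Nat.zero_mod, Nat.zero_div,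
    Nat.mod_eq_of_lt hd, Nat.div_eq_of_lt hd, pow_zero, if_true, zero_ne_one, one_ne_zero,
    if_false, smul_eq_mul, mul_zero, mul_one, zero_add, add_zero] at h0 h1
  rw [h1, zero_mul, add_zero] at h0
  exact ⟨h0, h1⟩

theorem Verma.linearIndependent (hd : 1 < dbar q) :
    LinearIndependent F ![Verma.m hq p 0, gen q Gen.A • Verma.m hq p 0] := by
  rw [LinearIndependent.pair_iff]
  intro r s h
  -- Any value of `δ` would serve: a dependence upstairs maps to one in the quotient.
  exact LinearIndependent.pair_iff.mp (W.linearIndependent hq p 0 hd) r s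
    (congrArg (O hq p 0).mkQ h)

variable {hq p δ} {V : Type*} [AddCommGroup V] [Module F V]
  [Module (UAW q) V] [IsScalarTower F (UAW q) V]

theorem W.hom_ext {f g : W hq p δ →ₗ[UAW q] V} (h : f (W.w hq p δ 0) = g (W.w hq p δ 0)) :
    f = g :=
  Submodule.linearMap_qext _ (Verma.hom_ext h)

/-- The spanning vectors of the submodule arise from the first by applying `A - θ_i` in turn,
because `θ` has period `đ`. So one relation suffices. -/
theorem O_le_ker {g : Verma hq p →ₗ[UAW q] V}
    (h : g (Verma.m hq p (dbar q)) = δ • g (Verma.m hq p 0)) : O hq p δ ≤ LinearMap.ker g := by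
  have hi : ∀ i, g (δ • Verma.m hq p i - Verma.m hq p (dbar q + i)) = 0 := by
    intro i
    induction i with
    | zero => rw [map_sub, g.map_smul_of_tower, add_zero, h, sub_self]
    | succ i ih =>
      have e : δ • Verma.m hq p (i + 1) - Verma.m hq p (dbar q + (i + 1)) =
          gen q Gen.A • (δ • Verma.m hq p i - Verma.m hq p (dbar q + i)) -
            theta q p i • (δ • Verma.m hq p i - Verma.m hq p (dbar q + i)) := by
        rw [← Nat.add_assoc, Verma.m_succ, Verma.m_succ, theta_dbar, smul_sub (gen q Gen.A),
          smul_comm (gen q Gen.A) δ]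
        generalize gen q Gen.A • Verma.m hq p i = u
        generalize gen q Gen.A • Verma.m hq p (dbar q + i) = v
        module
      rw [e, map_sub, map_smul, g.map_smul_of_tower, ih, smul_zero, smul_zero, sub_zero]
  have hs : Ospace hq p δ ≤ LinearMap.ker (g.restrictScalars F) := by
    refine Submodule.span_le.mpr ?_
    rintro _ ⟨i, rfl⟩
    exact hi i
  exact fun v hv => hs hv

end Quotient

/-! ### Homomorphisms, isomorphisms and the classification. -/

section Classification

variable {F : Type*} [Field F] [IsAlgClosed F] {q : Fˣ} {hq : q ^ 4 ≠ 1} {p p' : Quad F} {δ δ' : F}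

theorem exists_verma_hom_iff (hd : 1 < dbar q) : QuadEquiv q p p' ↔
    ∃ f : Verma hq p →ₗ[UAW q] Verma hq p', f (Verma.m hq p 0) = Verma.m hq p' 0 := by
  rw [quadEquiv_iff_sameData hq]
  constructor
  · intro h
    have hw := (Verma.isHighestWeight hq p').of_sameData h.symm
    exact ⟨Verma.lift hw, Verma.lift_m_zero hw⟩
  · rintro ⟨f, hf⟩
    have hw := (Verma.isHighestWeight hq p).map f
    rw [hf] at hw
    exact hw.sameData (Verma.isHighestWeight hq p') (Verma.linearIndependent hq p' hd)

theorem quintEquiv_iff : QuintEquiv q p δ p' δ' ↔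
    QuadEquiv q p p' ∧ δ + powerTrace q p = δ' + powerTrace q p' := by
  simp only [QuintEquiv, powerTrace, add_assoc]

theorem QuintEquiv.symm (h : QuintEquiv q p δ p' δ') : QuintEquiv q p' δ' p δ :=
  ⟨h.1.symm, h.2.symm⟩

theorem exists_W_hom_iff (hd : 1 < dbar q) : QuintEquiv q p δ p' δ' ↔
    ∃ f : W hq p δ →ₗ[UAW q] W hq p' δ', f (W.w hq p δ 0) = W.w hq p' δ' 0 := by
  have hd0 : 0 < dbar q := by omega
  have hK := W.aeval_smul hq p' δ'
  -- The relation in the target is rewritten with the polynomial of the source quadruple, so that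
  -- both modules are tested on one element of the algebra.
  rw [← thetaPoly_add_powerTrace hd0 p p'] at hK
  rw [quintEquiv_iff, quadEquiv_iff_sameData hq]
  constructor
  · rintro ⟨h, ht⟩
    have hw := (W.isHighestWeight hq p' δ').of_sameData h.symm
    have h0 := Verma.lift_m_zero (hq := hq) hw
    -- The vector `m_đ` goes to the image of `w_0` under the polynomial of `p` in `A`. By the
    -- relation `hK` and equality of the invariants `ht`, this is `δ w_0`.
    have hker : O hq p δ ≤ LinearMap.ker (Verma.lift (hq := hq) hw) := by
      apply O_le_ker
      rw [← aeval_thetaPoly_smul, map_smul, h0]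
      rw [← ht, map_add, aeval_C, add_smul, algebraMap_smul, add_smul] at hK
      exact add_right_cancel hK
    exact ⟨(O hq p δ).liftQ (Verma.lift (hq := hq) hw) hker, h0⟩
  · rintro ⟨f, hf⟩
    have hli := W.linearIndependent hq p' δ' hd
    have hw := (W.isHighestWeight hq p δ).map f
    rw [hf] at hw
    refine ⟨hw.sameData (W.isHighestWeight hq p' δ') hli, ?_⟩
    -- Transporting the eigenvalue relation along `f` puts two scalars on one nonzero vector.
    have h := congrArg f (W.aeval_smul hq p δ)
    rw [map_smul, f.map_smul_of_tower, hf, hK] at h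
    exact (smul_left_injective F (hli.ne_zero 0) h).symm

/-- Homomorphisms in both directions between modules generated by `m` and `n`, exchanging these
generators, are isomorphisms. -/
theorem exists_linearEquiv_of_homs {R M N : Type*} [Ring R] [AddCommGroup M] [Module R M]
    [AddCommGroup N] [Module R N] {m : M} {n : N}
    (hM : ∀ {f g : M →ₗ[R] M}, f m = g m → f = g) (hN : ∀ {f g : N →ₗ[R] N}, f n = g n → f = g)
    (hf : ∃ f : M →ₗ[R] N, f m = n) (hg : ∃ g : N →ₗ[R] M, g n = m) :
    ∃ e : M ≃ₗ[R] N, e m = n := by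
  obtain ⟨f, hf⟩ := hf
  obtain ⟨g, hg⟩ := hg
  exact ⟨LinearEquiv.ofLinearMap f g (hN (by simp [hf, hg])) (hM (by simp [hf, hg])), hf⟩

/-- The equivalences that follow formally from a symmetric criterion for the existence of
homomorphisms that preserve distinguished generators. -/
theorem tfae_of_iff_hom {R M N : Type*} [Ring R] [AddCommGroup M] [Module R M]
    [AddCommGroup N] [Module R N] {m : M} {n : N} {P : Prop}
    (hM : ∀ {f g : M →ₗ[R] M}, f m = g m → f = g) (hN : ∀ {f g : N →ₗ[R] N}, f n = g n → f = g)
    (hf : P ↔ ∃ f : M →ₗ[R] N, f m = n) (hg : P ↔ ∃ g : N →ₗ[R] M, g n = m) :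
    List.TFAE [P, ∃ f : M →ₗ[R] N, f m = n, ∃ f : N →ₗ[R] M, f n = m,
      ∃ f : M ≃ₗ[R] N, f m = n, ∃ f : N ≃ₗ[R] M, f n = m] := by
  tfae_have 1 ↔ 2 := hf
  tfae_have 1 ↔ 3 := hg
  tfae_have 1 → 4 := fun h => exists_linearEquiv_of_homs hM hN (hf.mp h) (hg.mp h)
  tfae_have 1 → 5 := fun h => exists_linearEquiv_of_homs hN hM (hg.mp h) (hf.mp h)
  tfae_have 4 → 2 := fun ⟨e, he⟩ => ⟨e.toLinearMap, he⟩
  tfae_have 5 → 3 := fun ⟨e, he⟩ => ⟨e.toLinearMap, he⟩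
  tfae_finish

end Classification

end AskeyWilson

end

theorem mainTheorem8 {F : Type*} [Field F] [IsAlgClosed F] (q : Fˣ) (hq : q ^ 4 ≠ 1)
    (hroot : IsOfFinOrder q) :
    (∀ p p' : AskeyWilson.Quad F,
      List.TFAE [
        AskeyWilson.QuadEquiv q p p',
        ∃ f : AskeyWilson.Verma hq p →ₗ[AskeyWilson.UAW q] AskeyWilson.Verma hq p',
          f (AskeyWilson.Verma.m hq p 0) = AskeyWilson.Verma.m hq p' 0,
        ∃ f : AskeyWilson.Verma hq p' →ₗ[AskeyWilson.UAW q] AskeyWilson.Verma hq p,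
          f (AskeyWilson.Verma.m hq p' 0) = AskeyWilson.Verma.m hq p 0,
        ∃ f : AskeyWilson.Verma hq p ≃ₗ[AskeyWilson.UAW q] AskeyWilson.Verma hq p',
          f (AskeyWilson.Verma.m hq p 0) = AskeyWilson.Verma.m hq p' 0,
        ∃ f : AskeyWilson.Verma hq p' ≃ₗ[AskeyWilson.UAW q] AskeyWilson.Verma hq p,
          f (AskeyWilson.Verma.m hq p' 0) = AskeyWilson.Verma.m hq p 0]) ∧
    (∀ (p : AskeyWilson.Quad F) (δ : F) (p' : AskeyWilson.Quad F) (δ' : F),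
      List.TFAE [
        AskeyWilson.QuintEquiv q p δ p' δ',
        ∃ f : AskeyWilson.W hq p δ →ₗ[AskeyWilson.UAW q] AskeyWilson.W hq p' δ',
          f (AskeyWilson.W.w hq p δ 0) = AskeyWilson.W.w hq p' δ' 0,
        ∃ f : AskeyWilson.W hq p' δ' →ₗ[AskeyWilson.UAW q] AskeyWilson.W hq p δ,
          f (AskeyWilson.W.w hq p' δ' 0) = AskeyWilson.W.w hq p δ 0,
        ∃ f : AskeyWilson.W hq p δ ≃ₗ[AskeyWilson.UAW q] AskeyWilson.W hq p' δ',
          f (AskeyWilson.W.w hq p δ 0) = AskeyWilson.W.w hq p' δ' 0,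
        ∃ f : AskeyWilson.W hq p' δ' ≃ₗ[AskeyWilson.UAW q] AskeyWilson.W hq p δ,
          f (AskeyWilson.W.w hq p' δ' 0) = AskeyWilson.W.w hq p δ 0]) := by
  have hd := AskeyWilson.one_lt_dbar hq hroot
  exact ⟨fun p p' => AskeyWilson.tfae_of_iff_hom AskeyWilson.Verma.hom_ext
      AskeyWilson.Verma.hom_ext (AskeyWilson.exists_verma_hom_iff hd)
      ((Iff.intro Eq.symm Eq.symm).trans (AskeyWilson.exists_verma_hom_iff hd)),
    fun p δ p' δ' => AskeyWilson.tfae_of_iff_hom AskeyWilson.W.hom_ext AskeyWilson.W.hom_ext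
      (AskeyWilson.exists_W_hom_iff hd)
      ((Iff.intro AskeyWilson.QuintEquiv.symm AskeyWilson.QuintEquiv.symm).trans
        (AskeyWilson.exists_W_hom_iff hd))⟩
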